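/- **Theorem 2.2 (Unique Ergodicity).** Let $(\mathbb X,d)$ be a nonempty compact metric space and $\mathbb Y$ a Polish space, both with their Borel $\sigma$-fields. Let $\mathcal T$ be a stochastic kernel from $\mathbb X$ to $\mathbb X$ and $\mathcal Q$ a stochastic kernel from $\mathbb X$ to $\mathbb Y$. For a prior $\mu\in\mathcal Z:=\mathbb P(\mathbb X)$ let $P^\mu$ be the law of the process $(X_n,Y_n)_{n\ge 0}$ with $$(X_0,Y_0)\sim \mu(dx_0)\,\mathcal Q(dy_0\mid x_0),\qquad \Pr\big((X_n,Y_n)\in B\mid (X,Y)_{[0,n-1]}=(x,y)_{[0,n-1]}\big)=\int_B \mathcal T(dx_n\mid x_{n-1})\,\mathcal Q(dy_n\mid x_n),\quad n\ge 1,$$ and let $\pi_n^\mu=P^\mu(X_n\in\cdot\mid Y_0,\dots,Y_n)$ be the filter process, a process in $\mathcal Z$, where $\mathcal Z$ carries the topology of weak convergence. Let $F(z,y)$ be the regular conditional law of $X_1$ given $Y_1=y$ when $X_0\sim z$, and let $\eta$ be the transition kernel of the filter process on $\mathcal Z$, $$\eta(A\mid z)=\int \mathbf 1_{\{F(z,y_1)\in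 A\}}\,\mathcal Q(dy_1\mid x_1)\,\mathcal T(dx_1\mid x_0)\,z(dx_0).$$ Assume: 1. there is $\alpha\ge 0$ such that $\|\mathcal T(\cdot\mid x)-\mathcal T(\cdot\mid x')\|_{TV}\le \alpha\, d(x,x')$ for all $x,x'\in\mathbb X$, where $\|\mu-\nu\|_{TV}=\sup\{|\int g\,d\mu-\int g\,d\nu| : g \text{ measurable},\ \|g\|_\infty\le 1\}$; 2. there is a topologically reachable state for $\eta$, i.e. a $z^*\in\mathcal Z$ such that for every $z\in\mathcal Z$ and every open neighborhood $O$ of $z^*$ there is $k\ge 1$ with $\eta^k(O\mid z)>0$. Then there is a unique probability measure $\nu$ on $\mathcal Z$ that is invariant under $\eta$. Moreover, if a topologically reachable state $z^*$ is also topologically aperiodic, i.e. for every open neighborhood $O$ of $z^*$ one has $\eta^k(O\mid z^*)>0$ for all sufficiently large $k$, then for every prior $\mu\in\mathcal Z$ the law of $\pi_n^\mu$ under $P^\mu$ converges weakly to $\nu$ as $n\to\infty$, and, more generally, for every initial distribution $m\in\mathbb P(\mathcal Z)$ the law $m\eta^n$ converges weakly to $\nu$ as $n\to\infty$. -/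

import Mathlib

open MeasureTheory ProbabilityTheory Filter Topology

namespace HMM

/-! ### The weak topology on probability measures and its Borel sigma-algebra

Mathlib equips `ProbabilityMeasure X` with the topology of weak convergence, and with the
sigma-algebra generated by the evaluations `μ ↦ μ A`. The latter is the Borel sigma-algebra
of the former when `X` is a compact metric space. -/

section Borel

variable {X : Type*} [MetricSpace X] [MeasurableSpace X] [BorelSpace X]

theorem borel_le [CompactSpace X] :
    borel (ProbabilityMeasure X) ≤ ProbabilityMeasure.instMeasurableSpace := by
  have htop : (inferInstance : TopologicalSpace (ProbabilityMeasure X)) =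
      TopologicalSpace.generateFrom
        {s | ∃ (f : BoundedContinuousFunction X NNReal) (u : Set ENNReal), IsOpen u ∧
          (fun μ : ProbabilityMeasure X => ∫⁻ x, (f x : ENNReal) ∂(μ : Measure X)) ⁻¹' u = s} := by
    refine le_antisymm ?_ ?_
    · refine le_generateFrom ?_
      rintro _ ⟨f, u, hu, rfl⟩
      refine hu.preimage ?_
      refine continuous_iff_continuousAt.2 fun μ => ?_
      exact (ProbabilityMeasure.tendsto_iff_forall_lintegral_tendsto.1 tendsto_id) f
    · refine le_of_nhds_le_nhds ?_
      intro μ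
      refine (tendsto_id'.1 ?_)
      rw [ProbabilityMeasure.tendsto_iff_forall_lintegral_tendsto]
      intro f
      refine tendsto_def.2 fun s hs => ?_
      obtain ⟨u, hus, hu, hmem⟩ := mem_nhds_iff.1 hs
      refine mem_of_superset ?_ (Set.preimage_mono hus)
      exact @IsOpen.mem_nhds _ (TopologicalSpace.generateFrom _) μ
        ((fun μ : ProbabilityMeasure X => ∫⁻ x, (f x : ENNReal) ∂(μ : Measure X)) ⁻¹' u)
        (TopologicalSpace.isOpen_generateFrom_of_mem ⟨f, u, hu, rfl⟩) hmem
  rw [borel_eq_generateFrom_of_subbasis htop]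
  refine MeasurableSpace.generateFrom_le ?_
  rintro _ ⟨f, u, hu, rfl⟩
  have hf : Measurable fun x => (f x : ENNReal) :=
    (ENNReal.continuous_coe.comp f.continuous).measurable
  exact ((Measure.measurable_lintegral hf).comp measurable_subtype_coe) hu.measurableSet

theorem le_borel :
    ProbabilityMeasure.instMeasurableSpace ≤ borel (ProbabilityMeasure X) := by
  have key : Measurable[borel (ProbabilityMeasure X)]
      (fun μ : ProbabilityMeasure X => (μ : Measure X)) := by
    let _ : MeasurableSpace (ProbabilityMeasure X) := borel _
    have _ : BorelSpace (ProbabilityMeasure X) := ⟨rfl⟩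
    refine Measurable.measure_of_isPiSystem_of_isProbabilityMeasure
      (S := {s : Set X | IsClosed s}) ?_ isPiSystem_isClosed ?_
    · rw [BorelSpace.measurable_eq (α := X), borel_eq_generateFrom_isClosed]
    · intro F hF
      refine UpperSemicontinuous.measurable fun μ => ?_
      refine upperSemicontinuousAt_iff_limsup_le.2 ?_
      exact ProbabilityMeasure.limsup_measure_closed_le_of_tendsto tendsto_id hF
  exact key.comap_le

instance [CompactSpace X] : BorelSpace (ProbabilityMeasure X) := ⟨le_antisymm le_borel borel_le⟩

end Borel

/-! ### Total variation norm -/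

/-- The total variation norm of the difference of two probability measures,
`‖μ - ν‖_TV = sup {|∫ g dμ - ∫ g dν| : g measurable, ‖g‖_∞ ≤ 1}`. -/
noncomputable def tvNorm {X : Type*} [MeasurableSpace X] (μ ν : Measure X) : ℝ :=
  sSup {r : ℝ | ∃ g : X → ℝ, Measurable g ∧ (∀ x, |g x| ≤ 1) ∧
    r = |∫ x, g x ∂μ - ∫ x, g x ∂ν|}

/-! ### Topological notions for a Markov chain with transition kernel `P`

`P ^ k` is the `k`-step transition kernel. -/

/-- `x` is topologically reachable: from every starting point, every open neighbourhood of `x` is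
charged after some positive number of steps. -/
def TopologicallyReachable {S : Type*} [TopologicalSpace S] [MeasurableSpace S]
    (P : Kernel S S) (x : S) : Prop :=
  ∀ (y : S) (O : Set S), IsOpen O → x ∈ O → ∃ k : ℕ, 0 < k ∧ 0 < (P ^ k) y O

/-- `x` is topologically aperiodic: every open neighbourhood of `x` is charged, starting from `x`,
after any sufficiently large number of steps. -/
def TopologicallyAperiodic {S : Type*} [TopologicalSpace S] [MeasurableSpace S]
    (P : Kernel S S) (x : S) : Prop :=
  ∀ O : Set S, IsOpen O → x ∈ O → ∃ K : ℕ, ∀ k : ℕ, K ≤ k → 0 < (P ^ k) x O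

theorem isMarkovKernel_pow {S : Type*} [MeasurableSpace S] (P : Kernel S S) [IsMarkovKernel P]
    (n : ℕ) : IsMarkovKernel (P ^ n) := by
  induction n with
  | zero => rw [pow_zero]; exact inferInstanceAs (IsMarkovKernel Kernel.id)
  | succ n ih => rw [pow_succ]; exact inferInstanceAs (IsMarkovKernel ((P ^ n) ∘ₖ P))

/-- The law at time `n` of the Markov chain with transition kernel `P` and initial law `m`. -/
noncomputable def chainLaw {S : Type*} [MeasurableSpace S] (P : Kernel S S) [IsMarkovKernel P]
    (m : ProbabilityMeasure S) (n : ℕ) : ProbabilityMeasure S :=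
  ⟨(P ^ n : Kernel S S) ∘ₘ (m : Measure S),
    have := isMarkovKernel_pow P n
    inferInstance⟩

section Model

variable {X Y : Type*} [MeasurableSpace X] [MeasurableSpace Y]

/-! ### The hidden Markov model -/

/-- One step of the pair chain `(X_n, Y_n)`: from `(x, y)`, draw `x' ~ T(· | x)` and then
`y' ~ Q(· | x')`. -/
noncomputable def pairKernel (T : Kernel X X) (Q : Kernel X Y) : Kernel (X × Y) (X × Y) :=
  (Kernel.id ×ₖ Q) ∘ₖ (T.comap Prod.fst measurable_fst)

instance (T : Kernel X X) (Q : Kernel X Y) [IsMarkovKernel T] [IsMarkovKernel Q] :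
    IsMarkovKernel (pairKernel T Q) := by unfold pairKernel; infer_instance

/-- The conditional law of `(X_{n+1}, Y_{n+1})` given the whole past `(X, Y)_{[0,n]}`. -/
noncomputable def pathKernel (T : Kernel X X) (Q : Kernel X Y) (n : ℕ) :
    Kernel (Finset.Iic n → X × Y) (X × Y) :=
  (pairKernel T Q).comap (fun p => p ⟨n, Finset.mem_Iic.2 le_rfl⟩) (measurable_pi_apply _)

instance (T : Kernel X X) (Q : Kernel X Y) [IsMarkovKernel T] [IsMarkovKernel Q] (n : ℕ) :
    IsMarkovKernel (pathKernel T Q n) := by unfold pathKernel; infer_instance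

/-- The law `P^μ` of `(X_n, Y_n)_{n ≥ 0}` on the path space, when `X_0` has law `μ` (the prior):
`(X_0, Y_0)` has law `μ(dx₀) Q(dy₀ | x₀)`, and the conditional law of `(X_{n+1}, Y_{n+1})` given
the past is `T(dx | x_n) Q(dy | x)`. -/
noncomputable def pathLaw (T : Kernel X X) (Q : Kernel X Y) [IsMarkovKernel T] [IsMarkovKernel Q]
    (μ : ProbabilityMeasure X) : Measure (ℕ → X × Y) :=
  Kernel.trajMeasure (X := fun _ => X × Y) ((μ : Measure X) ⊗ₘ Q) (pathKernel T Q)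

instance (T : Kernel X X) (Q : Kernel X Y) [IsMarkovKernel T] [IsMarkovKernel Q]
    (μ : ProbabilityMeasure X) : IsProbabilityMeasure (pathLaw T Q μ) := by
  unfold pathLaw; infer_instance

/-- The observations `Y_0, …, Y_n` along a path. -/
def observations (n : ℕ) (ω : ℕ → X × Y) : Finset.Iic n → Y := fun i => (ω i).2

/-! ### The filter process -/

variable [StandardBorelSpace X] [Nonempty X]

/-- The filter `π_n^μ = P^μ(X_n ∈ · | Y_0, …, Y_n)`, a random probability measure on `X`. -/
noncomputable def filter (T : Kernel X X) (Q : Kernel X Y) [IsMarkovKernel T] [IsMarkovKernel Q]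
    (μ : ProbabilityMeasure X) (n : ℕ) (ω : ℕ → X × Y) : ProbabilityMeasure X :=
  ⟨condDistrib (fun ω' : ℕ → X × Y => (ω' n).1) (observations n) (pathLaw T Q μ)
    (observations n ω), inferInstance⟩

theorem measurable_filter (T : Kernel X X) (Q : Kernel X Y) [IsMarkovKernel T] [IsMarkovKernel Q]
    (μ : ProbabilityMeasure X) (n : ℕ) : Measurable (filter T Q μ n) := by
  refine Measurable.subtype_mk ((Kernel.measurable _).comp ?_)
  exact measurable_pi_lambda _ fun i => (measurable_pi_apply _).snd

/-- The law of the filter `π_n^μ` under `P^μ`, a probability measure on `ProbabilityMeasure X`. -/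
noncomputable def filterLaw (T : Kernel X X) (Q : Kernel X Y) [IsMarkovKernel T] [IsMarkovKernel Q]
    (μ : ProbabilityMeasure X) (n : ℕ) : ProbabilityMeasure (ProbabilityMeasure X) :=
  ⟨(pathLaw T Q μ).map (filter T Q μ n),
    Measure.isProbabilityMeasure_map (measurable_filter T Q μ n).aemeasurable⟩

/-! ### The transition kernel of the filter process -/

theorem measurable_toMeasure {X : Type*} [MeasurableSpace X] :
    Measurable (fun z : ProbabilityMeasure X => (z : Measure X)) :=
  measurable_subtype_coe

/-- The kernel `z ↦ z` from `ProbabilityMeasure X` to `X`: draw a point of `X` with law `z`. -/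
noncomputable def evalKernel (X : Type*) [MeasurableSpace X] : Kernel (ProbabilityMeasure X) X where
  toFun z := (z : Measure X)
  measurable' := measurable_toMeasure

instance {X : Type*} [MeasurableSpace X] : IsMarkovKernel (evalKernel X) :=
  ⟨fun z => inferInstanceAs (IsProbabilityMeasure (z : Measure X))⟩

/-- The joint law of `(Y_{n+1}, X_{n+1})` when `X_n` has law `z`, that is
`z(dx_n) T(dx_{n+1} | x_n) Q(dy_{n+1} | x_{n+1})` integrated over `x_n`, as a kernel in `z`. -/
noncomputable def predictor {X Y : Type*} [MeasurableSpace X] [MeasurableSpace Y]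
    (T : Kernel X X) (Q : Kernel X Y) : Kernel (ProbabilityMeasure X) (Y × X) :=
  (Q ×ₖ Kernel.id) ∘ₖ T ∘ₖ evalKernel X

instance {X Y : Type*} [MeasurableSpace X] [MeasurableSpace Y]
    (T : Kernel X X) (Q : Kernel X Y) [IsMarkovKernel T] [IsMarkovKernel Q] :
    IsMarkovKernel (predictor T Q) := by
  unfold predictor; infer_instance

variable [StandardBorelSpace Y]

/-- The filter update `F(z, y) = Pr(X_{n+1} ∈ · | Z_n = z, Y_{n+1} = y)`: the regular conditional
law of `X_{n+1}` given `Y_{n+1} = y` when `X_n` has law `z`. -/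
noncomputable def update (T : Kernel X X) (Q : Kernel X Y) [IsMarkovKernel T] [IsMarkovKernel Q]
    (p : ProbabilityMeasure X × Y) : ProbabilityMeasure X :=
  ⟨(predictor T Q).condKernel p, inferInstance⟩

theorem measurable_update (T : Kernel X X) (Q : Kernel X Y) [IsMarkovKernel T] [IsMarkovKernel Q] :
    Measurable (update T Q) :=
  Measurable.subtype_mk (Kernel.measurable _)

/-- The transition kernel `η` of the filter process: `η(· | z)` is the law of `F(z, Y_{n+1})`,
where `Y_{n+1}` is distributed according to `z(dx_n) T(dx_{n+1} | x_n) Q(dy_{n+1} | x_{n+1})`. -/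
noncomputable def filterKernel (T : Kernel X X) (Q : Kernel X Y) [IsMarkovKernel T]
    [IsMarkovKernel Q] : Kernel (ProbabilityMeasure X) (ProbabilityMeasure X) :=
  (Kernel.id ×ₖ (predictor T Q).fst).map (update T Q)

instance (T : Kernel X X) (Q : Kernel X Y) [IsMarkovKernel T] [IsMarkovKernel Q] :
    IsMarkovKernel (filterKernel T Q) :=
  Kernel.IsMarkovKernel.map _ (measurable_update T Q)

end Model

end HMM

/-! The filter process is an e-chain on the compact space of probability measures: for each
continuous `f`, the functions `η^n f` are equicontinuous (`isEChain_filterKernel`). The rest is the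
classical theory of such chains.

Equicontinuity rests on convexity. Call `f` an envelope if `f z` is the supremum of `∫ φ dz` over a
set of continuous `φ` bounded by some `R`. Then `η f z` averages, over the observation `y`, the
supremum of `∫ φ dF(z, y)`. Choosing a near-optimal `φ` measurably in `y` moves the supremum outside
the average, and averaging the conditional laws removes the conditioning. So `η f` is a supremum of
functionals linear in `z`, with integrands `w ↦ ∫ T(w, dx) g(x)`, `|g| ≤ R`
(`IsEnvelope.filterKernel`). The total variation hypothesis makes these integrands `R *
α`-Lipschitz, and they are still bounded by `R`, so the constants do not grow under iteration. By
Arzelà–Ascoli all `η^n f`, `n ≥ 1`, are envelopes of subsets of one compact set of functions, whence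
equicontinuity. Differences of continuous envelopes are dense by the lattice form of
Stone–Weierstrass (`closure_sub_envelopes`), and `η^n` contracts the sup norm.

For an e-chain, Cesàro averages of `η^n f` have a continuous harmonic limit. By the maximum
principle at the reachable state it is constant, so it determines `∫ f dν` for every invariant `ν`;
existence is Krylov–Bogoliubov. With aperiodicity, two copies of the chain visit a small
neighbourhood of the state at a common time, with mass bounded below uniformly in their starting
points. This forces the oscillation of `η^n f` to zero (`IsEChain.exists_tendsto_const`). Finally,
the filter recursion shows that the laws of `π_n` form the chain started from the law of `π_0`
(`filterLaw_eq_chainLaw`). -/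

set_option linter.unusedSectionVars false

namespace HMM

/-! ### Integrals against iterated Markov kernels. -/

section Pow

variable {S : Type*} [MeasurableSpace S] (P : Kernel S S) [IsMarkovKernel P]

instance instIsMarkovKernelPow (n : ℕ) : IsMarkovKernel (P ^ n) := isMarkovKernel_pow P n

theorem integrable_of_bounded {f : S → ℝ} (hf : Measurable f) {R : ℝ} (hR : ∀ x, |f x| ≤ R)
    (μ : Measure S) [IsFiniteMeasure μ] : Integrable f μ :=
  Integrable.of_bound hf.aestronglyMeasurable R (ae_of_all _ hR)

theorem integral_pow_zero {f : S → ℝ} (hf : Measurable f) (x : S) :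
    ∫ y, f y ∂(P ^ 0) x = f x := by
  rw [pow_zero]
  exact integral_dirac' f x hf.stronglyMeasurable

theorem integral_pow_add {f : S → ℝ} (hf : Measurable f) {R : ℝ} (hR : ∀ x, |f x| ≤ R)
    (m n : ℕ) (x : S) :
    ∫ y, f y ∂(P ^ (m + n)) x = ∫ w, ∫ y, f y ∂(P ^ m) w ∂(P ^ n) x := by
  have h : P ^ (m + n) = (P ^ m) ∘ₖ (P ^ n) := pow_add P m n
  rw [h, Kernel.integral_comp]
  rw [← h]
  exact integrable_of_bounded hf hR _

theorem integral_pow_one (f : S → ℝ) (x : S) : ∫ y, f y ∂(P ^ 1) x = ∫ y, f y ∂P x := by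
  rw [pow_one]

theorem integral_measure_comp {S' : Type*} [MeasurableSpace S'] (κ : Kernel S S')
    [IsMarkovKernel κ] (m : Measure S) [IsFiniteMeasure m] {f : S' → ℝ} (hf : Integrable f (κ ∘ₘ m)) :
    ∫ y, f y ∂(κ ∘ₘ m) = ∫ x, ∫ y, f y ∂κ x ∂m := by
  -- A measure is a constant kernel on a one-point space.
  have h := Kernel.integral_comp (η := κ) (κ := Kernel.const Unit m) (a := ()) (f := f)
  rw [Kernel.comp_const, Kernel.const_apply, Kernel.const_apply] at h
  exact h hf

theorem integral_comp_pow {f : S → ℝ} (hf : Measurable f) {R : ℝ} (hR : ∀ x, |f x| ≤ R)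
    (n : ℕ) (m : Measure S) [IsFiniteMeasure m] :
    ∫ y, f y ∂((P ^ n : Kernel S S) ∘ₘ m) = ∫ x, ∫ y, f y ∂(P ^ n) x ∂m :=
  integral_measure_comp _ _ (integrable_of_bounded hf hR _)

theorem invariant_pow {ν : Measure S} (hν : Kernel.Invariant P ν) (n : ℕ) :
    (P ^ n : Kernel S S) ∘ₘ ν = ν := by
  induction n with
  | zero => rw [pow_zero]; exact Measure.id_comp
  | succ n ih =>
    have h : P ^ (n + 1) = (P ^ n) ∘ₖ P := pow_succ P n
    have h1 : P ∘ₘ ν = ν := hν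
    rw [h, ← Measure.comp_assoc, h1, ih]

theorem abs_integral_le_of_bounded {f : S → ℝ} {R : ℝ} (hR : ∀ x, |f x| ≤ R)
    (μ : Measure S) [IsProbabilityMeasure μ] : |∫ x, f x ∂μ| ≤ R := by
  simpa using norm_integral_le_of_norm_le_const (f := f) (μ := μ) (ae_of_all _ hR)

theorem integral_mem_Icc_of_forall {f : S → ℝ} (hf : Measurable f) {a b : ℝ}
    (h : ∀ x, a ≤ f x ∧ f x ≤ b) (μ : Measure S) [IsProbabilityMeasure μ] :
    a ≤ ∫ x, f x ∂μ ∧ ∫ x, f x ∂μ ≤ b := by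
  have hi : Integrable f μ := integrable_of_bounded hf
    (R := max |a| |b|) (fun x => abs_le_max_abs_abs (h x).1 (h x).2) μ
  constructor
  · simpa using integral_mono (integrable_const a) hi fun x => (h x).1
  · simpa using integral_mono hi (integrable_const b) fun x => (h x).2

end Pow

/-- The functions `x ↦ ∫ f d(P^n)(x, ·)`, `n ≥ 0`, are equicontinuous for every continuous `f`. -/
def IsEChain {S : Type*} [TopologicalSpace S] [MeasurableSpace S] (P : Kernel S S) : Prop :=
  ∀ f : C(S, ℝ), Equicontinuous fun (n : ℕ) (x : S) => ∫ y, f y ∂(P ^ n) x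

/-! ### Iterates of an e-chain and the maximum principle. -/

section EChain

variable {S : Type*} [TopologicalSpace S] [CompactSpace S] [MeasurableSpace S] [BorelSpace S]
  {P : Kernel S S} [IsMarkovKernel P]

theorem abs_le_norm (f : C(S, ℝ)) (x : S) : |f x| ≤ ‖f‖ := f.norm_coe_le_norm x

theorem integrable_continuousMap (f : C(S, ℝ)) (μ : Measure S) [IsFiniteMeasure μ] :
    Integrable f μ := integrable_of_bounded f.continuous.measurable (abs_le_norm f) μ

/-- The iterated transition operator on continuous functions. -/
noncomputable def IsEChain.iter (hE : IsEChain P) (n : ℕ) (f : C(S, ℝ)) : C(S, ℝ) :=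
  ⟨fun x => ∫ y, f y ∂(P ^ n) x, (hE f).continuous n⟩

variable (hE : IsEChain P)

theorem IsEChain.iter_apply (n : ℕ) (f : C(S, ℝ)) (x : S) :
    hE.iter n f x = ∫ y, f y ∂(P ^ n) x := rfl

theorem IsEChain.iter_add (m n : ℕ) (f : C(S, ℝ)) (x : S) :
    hE.iter (m + n) f x = ∫ y, hE.iter m f y ∂(P ^ n) x :=
  integral_pow_add P f.continuous.measurable (abs_le_norm f) m n x

theorem IsEChain.abs_iter_le (n : ℕ) (f : C(S, ℝ)) (x : S) : |hE.iter n f x| ≤ ‖f‖ :=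
  abs_integral_le_of_bounded (abs_le_norm f) _

/-- A nonnegative continuous function has a positive integral iff the open set where it is positive
is charged. -/
theorem integral_pos_iff_measure_pos (u : C(S, ℝ)) (hu : ∀ x, 0 ≤ u x) (μ : Measure S)
    [IsFiniteMeasure μ] : 0 < ∫ x, u x ∂μ ↔ 0 < μ {x | 0 < u x} := by
  rw [integral_pos_iff_support_of_nonneg hu (integrable_continuousMap u μ)]
  have : Function.support u = {x | 0 < u x} := by
    ext x; simp [Function.mem_support, (hu x).lt_iff_ne']
  rw [this]

theorem IsEChain.iter_nonneg {u : C(S, ℝ)} (hu : ∀ x, 0 ≤ u x) (n : ℕ) (x : S) :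
    0 ≤ hE.iter n u x := integral_nonneg hu

/-- A continuous harmonic function takes its maximum at every reachable point. -/
theorem IsEChain.harmonic_le_of_reachable {z : S} (hz : TopologicallyReachable P z)
    [Nonempty S] {g : C(S, ℝ)} (hg : ∀ x, ∫ y, g y ∂P x = g x) (x : S) : g x ≤ g z := by
  obtain ⟨x₀, -, hx₀'⟩ := isCompact_univ.exists_isMaxOn Set.univ_nonempty g.continuous.continuousOn
  have hx₀ : ∀ y, g y ≤ g x₀ := fun y => hx₀' (Set.mem_univ y)
  have hpow : ∀ n x, ∫ y, g y ∂(P ^ n) x = g x := by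
    intro n
    induction n with
    | zero => exact fun x => integral_pow_zero P g.continuous.measurable x
    | succ n ih =>
      intro x
      rw [integral_pow_add P g.continuous.measurable (abs_le_norm g) n 1, integral_pow_one]
      simp_rw [ih, hg]
  by_contra! hlt
  have hlt' : g z < g x₀ := hlt.trans_le (hx₀ x)
  -- From the maximiser `x₀` the chain charges an open set where `g < g x₀`, so the mean of `g x₀ -
  -- g` is positive; harmonicity makes it zero.
  obtain ⟨k, -, hk⟩ := hz x₀ {y | g y < g x₀} (isOpen_lt g.continuous continuous_const) hlt'
  have hpos : 0 < ∫ y, (ContinuousMap.const S (g x₀) - g) y ∂(P ^ k) x₀ := by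
    rw [integral_pos_iff_measure_pos _ (fun y => by simpa using hx₀ y)]
    simpa using hk
  simp only [ContinuousMap.sub_apply, ContinuousMap.const_apply] at hpos
  rw [integral_sub (integrable_const _) (integrable_continuousMap g _), hpow] at hpos
  simp at hpos

end EChain

/-! ### Cesàro averages: uniqueness and existence of the invariant measure. -/

section EChain

variable {S : Type*} [TopologicalSpace S] [CompactSpace S] [MeasurableSpace S] [BorelSpace S]
  {P : Kernel S S} [IsMarkovKernel P] (hE : IsEChain P)

/-- The Cesàro averages of the iterates of a continuous function. -/
noncomputable def IsEChain.avg (f : C(S, ℝ)) (n : ℕ) : C(S, ℝ) :=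
  ((n : ℝ) + 1)⁻¹ • ∑ k ∈ Finset.range (n + 1), hE.iter k f

theorem IsEChain.avg_apply (f : C(S, ℝ)) (n : ℕ) (x : S) :
    hE.avg f n x = ((n : ℝ) + 1)⁻¹ * ∑ k ∈ Finset.range (n + 1), hE.iter k f x := by
  simp [IsEChain.avg]

theorem abs_avg_le {a : ℕ → ℝ} {R : ℝ} (h : ∀ k, |a k| ≤ R) (n : ℕ) :
    |((n : ℝ) + 1)⁻¹ * ∑ k ∈ Finset.range (n + 1), a k| ≤ R := by
  have hn : (0 : ℝ) < (n : ℝ) + 1 := by positivity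
  have h1 : |∑ k ∈ Finset.range (n + 1), a k| ≤ ((n : ℝ) + 1) * R := by
    refine (Finset.abs_sum_le_sum_abs _ _).trans ((Finset.sum_le_sum fun k _ => h k).trans ?_)
    simp
  rw [abs_mul, abs_of_pos (inv_pos.2 hn), inv_mul_le_iff₀ hn]
  exact h1

/-- Cesàro averages of a bounded sequence and of its shift are asymptotically equal. -/
theorem tendsto_avg_shift_sub {a : ℕ → ℝ} {R : ℝ} (h : ∀ k, |a k| ≤ R) :
    Tendsto (fun n : ℕ => ((n : ℝ) + 1)⁻¹ * ∑ k ∈ Finset.range (n + 1), a (k + 1) -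
      ((n : ℝ) + 1)⁻¹ * ∑ k ∈ Finset.range (n + 1), a k) atTop (𝓝 0) := by
  have hlim : Tendsto (fun n : ℕ => 2 * R * (1 / ((n : ℝ) + 1))) atTop (𝓝 0) := by
    simpa using tendsto_one_div_add_atTop_nhds_zero_nat.const_mul (2 * R)
  refine squeeze_zero_norm (fun n => ?_) hlim
  have hn : (0 : ℝ) < (n : ℝ) + 1 := by positivity
  -- The sum telescopes to `a (n + 1) - a 0`, of size at most `2 * R`.
  rw [← mul_sub, ← Finset.sum_sub_distrib, Finset.sum_range_sub, Real.norm_eq_abs, abs_mul,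
    abs_of_pos (inv_pos.2 hn), one_div, mul_comm (2 * R)]
  refine mul_le_mul_of_nonneg_left ?_ (inv_pos.2 hn).le
  have h1 := abs_le.1 (h (n + 1))
  have h2 := abs_le.1 (h 0)
  exact abs_le.2 ⟨by linarith, by linarith⟩

theorem IsEChain.abs_avg_le (f : C(S, ℝ)) (n : ℕ) (x : S) : |hE.avg f n x| ≤ ‖f‖ := by
  rw [hE.avg_apply]
  exact HMM.abs_avg_le (fun k => hE.abs_iter_le k f x) n

theorem IsEChain.integral_avg (f : C(S, ℝ)) (n : ℕ) (μ : Measure S) [IsFiniteMeasure μ] :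
    ∫ x, hE.avg f n x ∂μ =
      ((n : ℝ) + 1)⁻¹ * ∑ k ∈ Finset.range (n + 1), ∫ x, hE.iter k f x ∂μ := by
  simp_rw [hE.avg_apply]
  rw [integral_const_mul, integral_finsetSum _ fun k _ => integrable_continuousMap _ _]

theorem IsEChain.integral_avg_kernel (f : C(S, ℝ)) (n : ℕ) (x : S) :
    ∫ y, hE.avg f n y ∂P x =
      ((n : ℝ) + 1)⁻¹ * ∑ k ∈ Finset.range (n + 1), hE.iter (k + 1) f x := by
  rw [hE.integral_avg]
  congr 1
  refine Finset.sum_congr rfl fun k _ => ?_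
  rw [hE.iter_add, integral_pow_one]

theorem IsEChain.equicontinuous_avg (f : C(S, ℝ)) :
    Equicontinuous fun (n : ℕ) (x : S) => hE.avg f n x := by
  intro x
  rw [Metric.equicontinuousAt_iff_right]
  intro ε hε
  filter_upwards [Metric.equicontinuousAt_iff_right.1 (hE f x) (ε / 2) (half_pos hε)] with y hy n
  rw [Real.dist_eq, hE.avg_apply, hE.avg_apply, ← mul_sub, ← Finset.sum_sub_distrib]
  refine (HMM.abs_avg_le (a := fun k => hE.iter k f x - hE.iter k f y) (fun k => ?_) n).trans_lt
    (half_lt_self hε)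
  exact (hy k).le

/-- Along a subsequence the Cesàro averages converge uniformly to a continuous harmonic
function. -/
theorem IsEChain.exists_harmonic_limit (f : C(S, ℝ)) :
    ∃ (g : C(S, ℝ)) (φ : ℕ → ℕ), StrictMono φ ∧ (∀ x, ∫ y, g y ∂P x = g x) ∧
      Tendsto (fun n => hE.avg f (φ n)) atTop (𝓝 g) := by
  let F : ℕ → BoundedContinuousFunction S ℝ := fun n => BoundedContinuousFunction.mkOfCompact (hE.avg f n)
  have hcomp : IsCompact (closure (Set.range F)) := by
    refine BoundedContinuousFunction.arzela_ascoli (Set.Icc (-‖f‖) ‖f‖) isCompact_Icc _ ?_ ?_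
    · rintro _ x ⟨n, rfl⟩
      exact abs_le.1 (hE.abs_avg_le f n x)
    · intro x
      have := hE.equicontinuous_avg f x
      rw [Metric.equicontinuousAt_iff_right] at this ⊢
      intro ε hε
      filter_upwards [this ε hε] with y hy
      rintro ⟨_, n, rfl⟩
      exact hy n
  obtain ⟨g, -, φ, hφ, hlim⟩ := hcomp.tendsto_subseq fun n => subset_closure (Set.mem_range_self n)
  have hlim' : Tendsto (fun n => hE.avg f (φ n)) atTop (𝓝 g.toContinuousMap) := by
    have := ((ContinuousMap.isometryEquivBoundedOfCompact S ℝ).symm.continuous.tendsto g).comp hlim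
    exact this
  refine ⟨g.toContinuousMap, φ, hφ, fun x => ?_, hlim'⟩
  have hpt : Tendsto (fun n => hE.avg f (φ n) x) atTop (𝓝 (g x)) :=
    ((continuous_eval_const x).tendsto _).comp hlim'
  have hint : Tendsto (fun n => ∫ y, hE.avg f (φ n) y ∂P x) atTop (𝓝 (∫ y, g y ∂P x)) := by
    refine tendsto_integral_of_dominated_convergence (fun _ => ‖f‖)
      (fun n => (hE.avg f (φ n)).continuous.measurable.aestronglyMeasurable)
      (integrable_const _) (fun n => ae_of_all _ fun y => hE.abs_avg_le f _ y)
      (ae_of_all _ fun y => ((continuous_eval_const y).tendsto _).comp hlim')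
  -- Applying `P` to an average shifts its index by one, which does not change the limit.
  have hsub := (tendsto_avg_shift_sub fun k => hE.abs_iter_le k f x).comp hφ.tendsto_atTop
  have := hint.sub hpt
  refine sub_eq_zero.1 (tendsto_nhds_unique this ?_)
  refine hsub.congr fun n => ?_
  rw [hE.integral_avg_kernel, hE.avg_apply, Function.comp_apply]

/-- If a state is reachable, then all invariant probability measures give the same integral to
a continuous function. -/
theorem IsEChain.integral_eq_of_invariant (hE : IsEChain P) {z : S} (hz : TopologicallyReachable P z)
    {ν₁ ν₂ : ProbabilityMeasure S} (h₁ : Kernel.Invariant P (ν₁ : Measure S))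
    (h₂ : Kernel.Invariant P (ν₂ : Measure S)) (f : C(S, ℝ)) :
    ∫ x, f x ∂(ν₁ : Measure S) = ∫ x, f x ∂(ν₂ : Measure S) := by
  have : Nonempty S := ⟨z⟩
  obtain ⟨g, φ, -, hg, hlim⟩ := hE.exists_harmonic_limit f
  have hconst : ∀ x, g x = g z := by
    intro x
    refine le_antisymm (harmonic_le_of_reachable hz hg x) ?_
    have := harmonic_le_of_reachable hz (g := -g) (fun x => by simp [integral_neg, hg]) x
    simpa using this
  have key : ∀ ν : ProbabilityMeasure S, Kernel.Invariant P (ν : Measure S) →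
      ∫ x, f x ∂(ν : Measure S) = g z := by
    intro ν hν
    have havg : ∀ n, ∫ x, hE.avg f n x ∂(ν : Measure S) = ∫ x, f x ∂(ν : Measure S) := by
      intro n
      have hk : ∀ k, ∫ x, hE.iter k f x ∂(ν : Measure S) = ∫ x, f x ∂(ν : Measure S) := by
        intro k
        simp_rw [hE.iter_apply]
        rw [← integral_comp_pow P f.continuous.measurable (abs_le_norm f), invariant_pow P hν]
      have hn : ((n : ℝ) + 1) ≠ 0 := by positivity
      rw [hE.integral_avg]
      simp only [hk, Finset.sum_const, Finset.card_range, nsmul_eq_mul]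
      push_cast
      field_simp
    have hint : Tendsto (fun n => ∫ x, hE.avg f (φ n) x ∂(ν : Measure S)) atTop
        (𝓝 (∫ x, g x ∂(ν : Measure S))) := by
      refine tendsto_integral_of_dominated_convergence (fun _ => ‖f‖)
        (fun n => (hE.avg f (φ n)).continuous.measurable.aestronglyMeasurable)
        (integrable_const _) (fun n => ae_of_all _ fun y => hE.abs_avg_le f _ y)
        (ae_of_all _ fun y => ((continuous_eval_const y).tendsto _).comp hlim)
    simp_rw [havg, hconst] at hint
    simpa using tendsto_nhds_unique tendsto_const_nhds hint
  rw [key ν₁ h₁, key ν₂ h₂]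

theorem measure_eq_of_forall_integral_continuousMap_eq [HasOuterApproxClosed S]
    {μ ν : Measure S} [IsFiniteMeasure μ] [IsFiniteMeasure ν]
    (h : ∀ f : C(S, ℝ), ∫ x, f x ∂μ = ∫ x, f x ∂ν) : μ = ν :=
  ext_of_forall_integral_eq_of_IsFiniteMeasure fun f => h f.toContinuousMap

/-- Krylov–Bogoliubov: an invariant probability measure exists. -/
theorem IsEChain.exists_invariant (hE : IsEChain P) [Nonempty S] [T2Space S] [HasOuterApproxClosed S] :
    ∃ ν : ProbabilityMeasure S, Kernel.Invariant P (ν : Measure S) := by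
  obtain ⟨x₀⟩ := ‹Nonempty S›
  have hne : ∀ n : ℕ, ((n : ENNReal) + 1) ≠ 0 := fun n => by positivity
  have hnt : ∀ n : ℕ, ((n : ENNReal) + 1) ≠ ⊤ := fun n => by finiteness
  let ρ : ℕ → ProbabilityMeasure S := fun n =>
    ⟨((n : ENNReal) + 1)⁻¹ • ∑ k ∈ Finset.range (n + 1), (P ^ k) x₀, ⟨by
      simp [ENNReal.inv_mul_cancel (hne n) (hnt n)]⟩⟩
  have hρ : ∀ (f : C(S, ℝ)) n, ∫ x, f x ∂(ρ n : Measure S) = hE.avg f n x₀ := by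
    intro f n
    change ∫ x, f x ∂(((n : ENNReal) + 1)⁻¹ • ∑ k ∈ Finset.range (n + 1), (P ^ k) x₀) = _
    rw [integral_smul_measure, integral_finsetSum_measure fun k _ => integrable_continuousMap _ _,
      hE.avg_apply]
    simp only [hE.iter_apply, smul_eq_mul]
    congr 1
    rw [ENNReal.toReal_inv, ENNReal.toReal_add (by finiteness) (by finiteness)]
    simp
  -- A limit along an ultrafilter replaces a convergent subsequence, so compactness alone suffices.
  obtain ⟨ν, -, hν⟩ := isCompact_univ.ultrafilter_le_nhds
    ((hyperfilter ℕ : Ultrafilter ℕ).map ρ) (by simp)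
  have hlim : ∀ f : C(S, ℝ), Tendsto (fun n => hE.avg f n x₀) (hyperfilter ℕ)
      (𝓝 (∫ x, f x ∂(ν : Measure S))) := by
    intro f
    have h := ProbabilityMeasure.tendsto_iff_forall_integral_tendsto.1
      (show Tendsto ρ (hyperfilter ℕ) (𝓝 ν) from hν) (BoundedContinuousFunction.mkOfCompact f)
    simpa [hρ] using h
  refine ⟨ν, measure_eq_of_forall_integral_continuousMap_eq fun f => ?_⟩
  have h1 : ∫ x, f x ∂(P ∘ₘ (ν : Measure S)) = ∫ x, hE.iter 1 f x ∂(ν : Measure S) := by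
    rw [integral_measure_comp _ _ (integrable_continuousMap _ _)]
    simp_rw [hE.iter_apply, integral_pow_one]
  change ∫ x, f x ∂(P ∘ₘ (ν : Measure S)) = _
  rw [h1]
  have hsub := (tendsto_avg_shift_sub fun k => hE.abs_iter_le k f x₀).mono_left
    (Nat.hyperfilter_le_atTop)
  refine sub_eq_zero.1 (tendsto_nhds_unique ((hlim (hE.iter 1 f)).sub (hlim f)) ?_)
  refine hsub.congr fun n => ?_
  rw [hE.avg_apply, hE.avg_apply]
  congr 2
  refine Finset.sum_congr rfl fun k _ => ?_
  rw [add_comm, hE.iter_add]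
  rfl

end EChain

/-! ### Convergence of an aperiodic e-chain. -/

section EChain

variable {S : Type*} [TopologicalSpace S] [CompactSpace S] [MeasurableSpace S] [BorelSpace S]
  {P : Kernel S S} [IsMarkovKernel P] (hE : IsEChain P)

theorem IsEChain.iter_add_pos {u : C(S, ℝ)} (hu : ∀ x, 0 ≤ u x) {m n : ℕ} {x : S}
    (h : 0 < (P ^ n) x {y | 0 < hE.iter m u y}) : 0 < hE.iter (m + n) u x := by
  rw [hE.iter_add, integral_pos_iff_measure_pos _ (hE.iter_nonneg hu m)]
  exact h

/-- If the neighbourhood `{0 < u}` of `z` is reachable, it is charged at a bounded time, uniformly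
in the starting point. -/
theorem IsEChain.exists_bound_iter_pos {z : S} (hz : TopologicallyReachable P z)
    {u : C(S, ℝ)} (hu : ∀ x, 0 ≤ u x) (huz : 0 < u z) :
    ∃ L, ∀ x, ∃ k ≤ L, 0 < hE.iter k u x := by
  have hcover : ∀ x, ∃ k, 0 < hE.iter k u x := by
    intro x
    obtain ⟨k, -, hk⟩ := hz x {y | 0 < u y} (isOpen_lt continuous_const u.continuous) huz
    exact ⟨k, (integral_pos_iff_measure_pos u hu _).2 hk⟩
  obtain ⟨t, ht⟩ := isCompact_univ.elim_finite_subcover (fun k => {x | 0 < hE.iter k u x})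
    (fun k => isOpen_lt continuous_const (hE.iter k u).continuous)
    (fun x _ => Set.mem_iUnion.2 (hcover x))
  refine ⟨t.sup id, fun x => ?_⟩
  obtain ⟨k, hk, hkx⟩ := Set.mem_iUnion₂.1 (ht (Set.mem_univ x))
  exact ⟨k, Finset.le_sup (f := id) hk, hkx⟩

/-- Two copies of the chain charge a neighbourhood of a reachable aperiodic state at a common
time. -/
theorem IsEChain.exists_common_iter_pos {z : S} (hz : TopologicallyReachable P z)
    (hza : TopologicallyAperiodic P z) {u : C(S, ℝ)} (hu : ∀ x, 0 ≤ u x) (huz : 0 < u z)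
    (x y : S) : ∃ k, 0 < hE.iter k u x ∧ 0 < hE.iter k u y := by
  obtain ⟨L, hL⟩ := hE.exists_bound_iter_pos hz hu huz
  obtain ⟨K, hK⟩ := hza {y | 0 < u y} (isOpen_lt continuous_const u.continuous) huz
  -- From this neighbourhood of `z` every time in the window `K, …, K + L` charges `{0 < u}`. Hence
  -- `y` charges it throughout a window of length `L`, while `x`, wherever it is when the window
  -- opens, charges it at some time within.
  have hV : IsOpen (⋂ j ∈ Finset.range (L + 1), {w | 0 < hE.iter (K + j) u w}) :=
    isOpen_biInter_finset fun j _ => isOpen_lt continuous_const (hE.iter (K + j) u).continuous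
  obtain ⟨k₂, -, hk₂⟩ := hz y _ hV (Set.mem_iInter₂.2 fun j _ =>
    (integral_pos_iff_measure_pos u hu _).2 (hK (K + j) (Nat.le_add_right K j)))
  have hy : ∀ j ≤ L, 0 < hE.iter (K + j + k₂) u y := fun j hj =>
    hE.iter_add_pos hu (hk₂.trans_le
      (measure_mono (Set.biInter_subset_of_mem (Finset.mem_coe.2 (Finset.mem_range_succ_iff.2 hj)))))
  have hx : ∃ j ≤ L, 0 < hE.iter (j + (K + k₂)) u x := by
    by_contra! hcon
    have hzero : ∀ j ≤ L, (P ^ (K + k₂)) x {w | 0 < hE.iter j u w} = 0 := by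
      intro j hj
      by_contra hne
      exact (hcon j hj).not_gt (hE.iter_add_pos hu (pos_iff_ne_zero.2 hne))
    have hun : (P ^ (K + k₂)) x (⋃ j ∈ Finset.range (L + 1), {w | 0 < hE.iter j u w}) = 0 :=
      (measure_biUnion_null_iff (Finset.range (L + 1)).countable_toSet).2 fun j hj =>
        hzero j (Finset.mem_range_succ_iff.1 (Finset.mem_coe.1 hj))
    have huniv : (⋃ j ∈ Finset.range (L + 1), {w | 0 < hE.iter j u w}) = Set.univ := by
      refine Set.eq_univ_of_forall fun w => ?_
      obtain ⟨j, hj, hjw⟩ := hL w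
      exact Set.mem_iUnion₂.2 ⟨j, Finset.mem_range_succ_iff.2 hj, hjw⟩
    rw [huniv, measure_univ] at hun
    exact one_ne_zero hun
  obtain ⟨j, hj, hjx⟩ := hx
  refine ⟨K + j + k₂, ?_, hy j hj⟩
  rwa [show K + j + k₂ = j + (K + k₂) by ring]

/-- A version of `exists_common_iter_pos` that is uniform in the starting points. -/
theorem IsEChain.exists_uniform_common_iter [Nonempty S] {z : S}
    (hz : TopologicallyReachable P z) (hza : TopologicallyAperiodic P z) {u : C(S, ℝ)}
    (hu : ∀ x, 0 ≤ u x) (huz : 0 < u z) :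
    ∃ (β : ℝ) (K : ℕ), 0 < β ∧ ∀ x y, ∃ k ≤ K, β ≤ hE.iter k u x ∧ β ≤ hE.iter k u y := by
  -- One index `n` controls both the time (at most `n`) and the mass (above `1 / (n + 1)`), so the
  -- largest index of a finite subcover serves every pair.
  obtain ⟨t, ht⟩ := (isCompact_univ (X := S × S)).elim_finite_subcover
    (fun n : ℕ => {p : S × S | ∃ k ≤ n, 1 / ((n : ℝ) + 1) < hE.iter k u p.1 ∧
      1 / ((n : ℝ) + 1) < hE.iter k u p.2})
    (fun n => by
      have : {p : S × S | ∃ k ≤ n, 1 / ((n : ℝ) + 1) < hE.iter k u p.1 ∧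
          1 / ((n : ℝ) + 1) < hE.iter k u p.2} =
          ⋃ k ≤ n, {p : S × S | 1 / ((n : ℝ) + 1) < hE.iter k u p.1} ∩
            {p : S × S | 1 / ((n : ℝ) + 1) < hE.iter k u p.2} := by
        ext p
        simp only [Set.mem_iUnion, Set.mem_inter_iff, Set.mem_ofPred_eq, exists_prop]
      rw [this]
      exact isOpen_biUnion fun k _ =>
        (isOpen_lt continuous_const ((hE.iter k u).continuous.comp continuous_fst)).inter
          (isOpen_lt continuous_const ((hE.iter k u).continuous.comp continuous_snd)))
    (by
      rintro ⟨x, y⟩ -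
      obtain ⟨k, hkx, hky⟩ := hE.exists_common_iter_pos hz hza hu huz x y
      obtain ⟨n, hn⟩ := exists_nat_one_div_lt (lt_min hkx hky)
      refine Set.mem_iUnion.2 ⟨max n k, k, le_max_right _ _, ?_⟩
      have hle : 1 / (((max n k : ℕ) : ℝ) + 1) ≤ 1 / ((n : ℝ) + 1) :=
        Nat.one_div_le_one_div (le_max_left _ _)
      exact ⟨(hle.trans_lt hn).trans_le (min_le_left _ _),
        (hle.trans_lt hn).trans_le (min_le_right _ _)⟩)
  refine ⟨1 / (((t.sup id : ℕ) : ℝ) + 1), t.sup id, Nat.one_div_pos_of_nat, fun x y => ?_⟩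
  obtain ⟨n, hn, k, hk, hx, hy⟩ := Set.mem_iUnion₂.1 (ht (Set.mem_univ (x, y)))
  have hnt : n ≤ t.sup id := Finset.le_sup (f := id) hn
  have hle : 1 / (((t.sup id : ℕ) : ℝ) + 1) ≤ 1 / ((n : ℝ) + 1) := Nat.one_div_le_one_div hnt
  exact ⟨k, hk.trans hnt, hle.trans hx.le, hle.trans hy.le⟩

/-- The minorisation estimate: if `h` is within `ε` of `c` on the support of `u ≤ 1`, the
probability measures `μ` and `ν` both give `u` mass at least `β`, then the difference of the
integrals of `h` is smaller than its oscillation. -/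
theorem integral_sub_integral_le_of_minorized {h u : C(S, ℝ)} {a b c ε β : ℝ}
    (hab : ∀ x, a ≤ h x ∧ h x ≤ b) (hu : ∀ x, 0 ≤ u x ∧ u x ≤ 1) (hβ : 0 ≤ β)
    (hc : ∀ x, 0 < u x → |h x - c| ≤ ε) (μ ν : Measure S) [IsProbabilityMeasure μ]
    [IsProbabilityMeasure ν] (hμ : β ≤ ∫ x, u x ∂μ) (hν : β ≤ ∫ x, u x ∂ν) :
    ∫ x, h x ∂μ - ∫ x, h x ∂ν ≤ (b - a) - β * (b - a - 2 * ε) := by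
  -- On the support of `u` the gap `b - h` is at least `b - c - ε`; truncating at zero keeps the
  -- bound valid elsewhere. The two gaps add up to at least `b - a - 2 * ε`, which does not involve
  -- `c`.
  have h1 : max (b - c - ε) 0 * ∫ x, u x ∂μ ≤ b - ∫ x, h x ∂μ := by
    have : ∫ x, max (b - c - ε) 0 * u x ∂μ ≤ ∫ x, (b - h x) ∂μ := by
      refine integral_mono ((integrable_continuousMap u μ).const_mul _)
        ((integrable_const b).sub (integrable_continuousMap h μ)) fun x => ?_
      change max (b - c - ε) 0 * u x ≤ b - h x
      rcases (hu x).1.eq_or_lt with h0 | h0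
      · rw [← h0, mul_zero]; linarith [(hab x).2]
      · refine (mul_le_of_le_one_right (le_max_right _ _) (hu x).2).trans (max_le ?_ ?_)
        · linarith [(abs_le.1 (hc x h0)).2]
        · linarith [(hab x).2]
    rw [integral_const_mul, integral_sub (integrable_const b) (integrable_continuousMap h μ)] at this
    simpa using this
  have h2 : max (c - a - ε) 0 * ∫ x, u x ∂ν ≤ ∫ x, h x ∂ν - a := by
    have : ∫ x, max (c - a - ε) 0 * u x ∂ν ≤ ∫ x, (h x - a) ∂ν := by
      refine integral_mono ((integrable_continuousMap u ν).const_mul _)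
        ((integrable_continuousMap h ν).sub (integrable_const a)) fun x => ?_
      change max (c - a - ε) 0 * u x ≤ h x - a
      rcases (hu x).1.eq_or_lt with h0 | h0
      · rw [← h0, mul_zero]; linarith [(hab x).1]
      · refine (mul_le_of_le_one_right (le_max_right _ _) (hu x).2).trans (max_le ?_ ?_)
        · linarith [(abs_le.1 (hc x h0)).1]
        · linarith [(hab x).1]
    rw [integral_const_mul, integral_sub (integrable_continuousMap h ν) (integrable_const a)] at this
    simpa using this
  have h3 := mul_le_mul_of_nonneg_left hμ (le_max_right (b - c - ε) 0)
  have h4 := mul_le_mul_of_nonneg_left hν (le_max_right (c - a - ε) 0)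
  have h5 := mul_le_mul_of_nonneg_left (le_max_left (b - c - ε) 0) hβ
  have h6 := mul_le_mul_of_nonneg_left (le_max_left (c - a - ε) 0) hβ
  linarith

/-- The bounds are the attained extrema of the iterates; they are monotone because each iterate is
an average of the preceding one. -/
theorem IsEChain.exists_iter_bounds [Nonempty S] (f : C(S, ℝ)) :
    ∃ M m : ℕ → ℝ, Antitone M ∧ Monotone m ∧ (∀ n x, m n ≤ hE.iter n f x ∧ hE.iter n f x ≤ M n) ∧
      (∀ n, ∃ x, hE.iter n f x = M n) ∧ (∀ n, ∃ x, hE.iter n f x = m n) := by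
  have hmax : ∀ n, ∃ x, ∀ y, hE.iter n f y ≤ hE.iter n f x := fun n => by
    obtain ⟨x, -, hx⟩ := isCompact_univ.exists_isMaxOn Set.univ_nonempty
      (hE.iter n f).continuous.continuousOn
    exact ⟨x, fun y => hx (Set.mem_univ y)⟩
  have hmin : ∀ n, ∃ x, ∀ y, hE.iter n f x ≤ hE.iter n f y := fun n => by
    obtain ⟨x, -, hx⟩ := isCompact_univ.exists_isMinOn Set.univ_nonempty
      (hE.iter n f).continuous.continuousOn
    exact ⟨x, fun y => hx (Set.mem_univ y)⟩
  choose p hp using hmax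
  choose q hq using hmin
  have hstep : ∀ n x, hE.iter n f (q n) ≤ hE.iter (n + 1) f x ∧
      hE.iter (n + 1) f x ≤ hE.iter n f (p n) := fun n x => by
    rw [hE.iter_add]
    exact integral_mem_Icc_of_forall (hE.iter n f).continuous.measurable
      (fun y => ⟨hq n y, hp n y⟩) _
  exact ⟨fun n => hE.iter n f (p n), fun n => hE.iter n f (q n),
    antitone_nat_of_succ_le fun n => (hstep n _).2, monotone_nat_of_le_succ fun n => (hstep n _).1,
    fun n x => ⟨hq n x, hp n x⟩, fun n => ⟨p n, rfl⟩, fun n => ⟨q n, rfl⟩⟩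

/-- If there is a reachable aperiodic state, the iterates of a continuous function converge
uniformly to a constant. -/
theorem IsEChain.exists_tendsto_const [T2Space S] {z : S}
    (hz : TopologicallyReachable P z) (hza : TopologicallyAperiodic P z) (f : C(S, ℝ)) :
    ∃ (M m : ℕ → ℝ) (c : ℝ), (∀ n x, m n ≤ hE.iter n f x ∧ hE.iter n f x ≤ M n) ∧
      Tendsto M atTop (𝓝 c) ∧ Tendsto m atTop (𝓝 c) := by
  have : Nonempty S := ⟨z⟩
  obtain ⟨M, m, hM, hm, hb, hMx, hmx⟩ := hE.exists_iter_bounds f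
  have hmM : ∀ n, m n ≤ M n := fun n => (hb n z).1.trans (hb n z).2
  have hMb : BddBelow (Set.range M) := ⟨m 0, by
    rintro _ ⟨n, rfl⟩; exact (hm (Nat.zero_le n)).trans (hmM n)⟩
  have hmb : BddAbove (Set.range m) := ⟨M 0, by
    rintro _ ⟨n, rfl⟩; exact (hmM n).trans (hM (Nat.zero_le n))⟩
  have hMlim := tendsto_atTop_ciInf hM hMb
  have hmlim := tendsto_atTop_ciSup hm hmb
  have hle := le_of_tendsto_of_tendsto' hmlim hMlim hmM
  rcases hle.eq_or_lt with heq | hlt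
  · exact ⟨M, m, _, hb, hMlim, heq ▸ hmlim⟩
  exfalso
  set D := (⨅ n, M n) - ⨆ n, m n with hD
  have hDpos : 0 < D := sub_pos.2 hlt
  have hDle : ∀ n, D ≤ M n - m n := fun n => sub_le_sub (ciInf_le hMb n) (le_ciSup hmb n)
  obtain ⟨O, hO, hOo, hzO⟩ := eventually_nhds_iff.1
    (Metric.equicontinuousAt_iff_right.1 (hE f z) (D / 8) (by positivity))
  obtain ⟨u, hu0, hu1, huI⟩ := exists_continuous_zero_one_of_isClosed hOo.isClosed_compl
    isClosed_singleton (Set.disjoint_singleton_right.2 (by simpa using hzO))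
  have huz : u z = 1 := hu1 rfl
  obtain ⟨β, K, hβ, hK⟩ := hE.exists_uniform_common_iter hz hza (u := u) (fun x => (huI x).1)
    (by rw [huz]; exact one_pos)
  -- At time `n₀` the oscillation exceeds its limit `D` by less than `β * D / 2`, whereas
  -- minorisation with `ε = D / 8` lowers it by at least `3 * β * D / 4`, hence below `D`.
  obtain ⟨n₀, hn₀⟩ := ((hMlim.sub hmlim).eventually_lt_const
    (show D < D + β * D / 2 by linarith [mul_pos hβ hDpos])).exists
  obtain ⟨x, hx⟩ := hMx (n₀ + K)
  obtain ⟨y, hy⟩ := hmx (n₀ + K)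
  -- The meeting time `k` depends on the extremal points `x`, `y`, so the horizon `K` is fixed
  -- beforehand and the remaining `K - k` steps are absorbed into `h`.
  obtain ⟨k, hk, hkx, hky⟩ := hK x y
  have hsplit : n₀ + K = (n₀ + (K - k)) + k := by omega
  have hh : ∀ w, m n₀ ≤ hE.iter (n₀ + (K - k)) f w ∧ hE.iter (n₀ + (K - k)) f w ≤ M n₀ := fun w =>
    ⟨(hm (Nat.le_add_right _ _)).trans (hb _ w).1, (hb _ w).2.trans (hM (Nat.le_add_right _ _))⟩
  have hest := integral_sub_integral_le_of_minorized (h := hE.iter (n₀ + (K - k)) f) (u := u)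
    (c := hE.iter (n₀ + (K - k)) f z) (ε := D / 8) hh huI hβ.le (fun w hw => by
      have hwO : w ∈ O := by
        by_contra hcon
        exact hw.ne' (hu0 hcon)
      have := hO w hwO (n₀ + (K - k))
      rw [dist_comm, Real.dist_eq] at this
      exact this.le) ((P ^ k) x) ((P ^ k) y) hkx hky
  rw [← hE.iter_add, ← hE.iter_add, ← hsplit, hx, hy] at hest
  have h1 := hDle (n₀ + K)
  have h2 := mul_le_mul_of_nonneg_left (hDle n₀) hβ.le
  have h3 := mul_pos hβ hDpos
  linarith

/-- If there is a reachable aperiodic state, the chain converges weakly to its invariant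
probability measure from every initial law. -/
theorem IsEChain.tendsto_chainLaw [T2Space S] (hE : IsEChain P) {z : S}
    (hz : TopologicallyReachable P z) (hza : TopologicallyAperiodic P z) {ν : ProbabilityMeasure S}
    (hν : Kernel.Invariant P (ν : Measure S)) (μ : ProbabilityMeasure S) :
    Tendsto (fun n => chainLaw P μ n) atTop (𝓝 ν) := by
  rw [ProbabilityMeasure.tendsto_iff_forall_integral_tendsto]
  intro f
  obtain ⟨M, m, c, hb, hM, hm⟩ := hE.exists_tendsto_const hz hza f.toContinuousMap
  have hbound : ∀ (ρ : Measure S) [IsProbabilityMeasure ρ] n,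
      m n ≤ ∫ x, f x ∂((P ^ n : Kernel S S) ∘ₘ ρ) ∧
        ∫ x, f x ∂((P ^ n : Kernel S S) ∘ₘ ρ) ≤ M n := by
    intro ρ _ n
    rw [integral_comp_pow P f.continuous.measurable (abs_le_norm f.toContinuousMap)]
    exact integral_mem_Icc_of_forall (hE.iter n f.toContinuousMap).continuous.measurable (hb n) ρ
  have hc : ∫ x, f x ∂(ν : Measure S) = c := by
    have h1 := fun n => hbound (ν : Measure S) n
    simp_rw [invariant_pow P hν] at h1
    exact le_antisymm (ge_of_tendsto' hM fun n => (h1 n).2) (le_of_tendsto' hm fun n => (h1 n).1)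
  rw [hc]
  exact tendsto_of_tendsto_of_tendsto_of_le_of_le hm hM (fun n => (hbound (μ : Measure S) n).1)
    (fun n => (hbound (μ : Measure S) n).2)

end EChain

/-! ### Disintegration formulas for the filter kernel. -/

section Filter

variable {X Y : Type*} [MeasurableSpace X] [MeasurableSpace Y]

theorem abs_sub_integral_le_tvNorm {μ ν : Measure X} [IsProbabilityMeasure μ]
    [IsProbabilityMeasure ν] {g : X → ℝ} (hg : Measurable g) {R : ℝ} (hR : ∀ x, |g x| ≤ R) :
    |∫ x, g x ∂μ - ∫ x, g x ∂ν| ≤ R * tvNorm μ ν := by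
  -- For an unbounded set `sSup` would be the default value `0`.
  have hbdd : BddAbove {r : ℝ | ∃ g : X → ℝ, Measurable g ∧ (∀ x, |g x| ≤ 1) ∧
      r = |∫ x, g x ∂μ - ∫ x, g x ∂ν|} := by
    refine ⟨2, ?_⟩
    rintro _ ⟨g, -, hg1, rfl⟩
    have h1 := abs_le.1 (abs_integral_le_of_bounded hg1 μ)
    have h2 := abs_le.1 (abs_integral_le_of_bounded hg1 ν)
    exact abs_le.2 ⟨by linarith, by linarith⟩
  have hX : Nonempty X := nonempty_of_isProbabilityMeasure μ
  obtain ⟨x₀⟩ := hX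
  rcases ((abs_nonneg _).trans (hR x₀)).eq_or_lt with h0 | h0
  · have hz : ∀ x, g x = 0 := fun x => abs_nonpos_iff.1 (h0 ▸ hR x)
    simp [hz, ← h0]
  · have := le_csSup hbdd ⟨fun x => R⁻¹ * g x, hg.const_mul _, fun x => by
      rw [abs_mul, abs_of_pos (inv_pos.2 h0), inv_mul_le_iff₀ h0, mul_one]; exact hR x, rfl⟩
    rw [integral_const_mul, integral_const_mul, ← mul_sub, abs_mul, abs_of_pos (inv_pos.2 h0),
      inv_mul_le_iff₀ h0] at this
    exact this

theorem integral_predictor (T : Kernel X X) (Q : Kernel X Y) [IsMarkovKernel T] [IsMarkovKernel Q]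
    {g : Y × X → ℝ} (hg : Measurable g) {R : ℝ} (hR : ∀ p, |g p| ≤ R) (z : ProbabilityMeasure X) :
    ∫ p, g p ∂predictor T Q z = ∫ w, ∫ x, ∫ y, g (y, x) ∂Q x ∂T w ∂(z : Measure X) := by
  have hi : ∀ (μ : Measure (Y × X)) [IsFiniteMeasure μ], Integrable g μ := fun μ _ =>
    integrable_of_bounded hg hR μ
  unfold predictor
  rw [Kernel.integral_comp (hi _)]
  change ∫ w, ∫ p, g p ∂((Q ×ₖ Kernel.id) ∘ₖ T) w ∂(z : Measure X) = _
  congr 1 with w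
  rw [Kernel.integral_comp (hi _)]
  congr 1 with x
  rw [Kernel.prod_apply, Kernel.id_apply, integral_prod _ (hi _)]
  congr 1 with y
  exact integral_dirac' _ x (hg.comp measurable_prodMk_left).stronglyMeasurable

variable [StandardBorelSpace X] [Nonempty X] [StandardBorelSpace Y]

theorem integral_predictor_eq_integral_update (T : Kernel X X) (Q : Kernel X Y) [IsMarkovKernel T]
    [IsMarkovKernel Q] {g : Y × X → ℝ} (hg : Measurable g) {R : ℝ} (hR : ∀ p, |g p| ≤ R)
    (z : ProbabilityMeasure X) :
    ∫ p, g p ∂predictor T Q z =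
      ∫ y, ∫ x, g (y, x) ∂(update T Q (z, y) : Measure X) ∂(predictor T Q).fst z := by
  conv_lhs => rw [← (predictor T Q).disintegrate (predictor T Q).condKernel]
  rw [ProbabilityTheory.integral_compProd (integrable_of_bounded hg hR _)]
  rfl

theorem integral_filterKernel (T : Kernel X X) (Q : Kernel X Y) [IsMarkovKernel T]
    [IsMarkovKernel Q] {f : ProbabilityMeasure X → ℝ} (hf : Measurable f) {R : ℝ}
    (hR : ∀ z, |f z| ≤ R) (z : ProbabilityMeasure X) :
    ∫ z', f z' ∂filterKernel T Q z = ∫ y, f (update T Q (z, y)) ∂(predictor T Q).fst z := by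
  have hm : Measurable fun p => f (update T Q p) := hf.comp (measurable_update T Q)
  unfold filterKernel
  rw [Kernel.map_apply _ (measurable_update T Q),
    integral_map (measurable_update T Q).aemeasurable hf.aestronglyMeasurable, Kernel.prod_apply,
    Kernel.id_apply, integral_prod _ (integrable_of_bounded hm (fun p => hR _) _)]
  exact integral_dirac' _ z (hm.stronglyMeasurable.integral_prod_right')

end Filter

/-! ### Envelopes of linear functionals. -/

section Support

variable {X : Type*} [MetricSpace X] [CompactSpace X] [MeasurableSpace X] [BorelSpace X]

/-- `f` is the upper envelope of the linear functionals `z ↦ ∫ φ dz`, `φ ∈ A`. -/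
def IsEnvelope (A : Set C(X, ℝ)) (f : ProbabilityMeasure X → ℝ) : Prop :=
  ∀ z : ProbabilityMeasure X, IsLUB ((fun φ : C(X, ℝ) => ∫ x, φ x ∂(z : Measure X)) '' A) (f z)

/-- The functions that are bounded by `R` and `a`-Lipschitz. -/
def boundedLipschitz (X : Type*) [MetricSpace X] (R a : ℝ) : Set C(X, ℝ) :=
  {φ | (∀ x, |φ x| ≤ R) ∧ ∀ x x', |φ x - φ x'| ≤ a * dist x x'}

theorem isCompact_boundedLipschitz (R a : ℝ) : IsCompact (boundedLipschitz X R a) := by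
  let e := ContinuousMap.isometryEquivBoundedOfCompact X ℝ
  have hcl : IsClosed (boundedLipschitz X R a) := by
    have h1 : boundedLipschitz X R a = (⋂ x, {φ : C(X, ℝ) | |φ x| ≤ R}) ∩
        ⋂ x, ⋂ x', {φ : C(X, ℝ) | |φ x - φ x'| ≤ a * dist x x'} := by
      ext φ
      simp [boundedLipschitz]
    rw [h1]
    refine (isClosed_iInter fun x => ?_).inter (isClosed_iInter fun x => isClosed_iInter fun x' => ?_)
    · exact isClosed_le (continuous_eval_const x).abs continuous_const
    · exact isClosed_le ((continuous_eval_const x).sub (continuous_eval_const x')).abs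
        continuous_const
  have himg : IsCompact (e '' boundedLipschitz X R a) := by
    refine BoundedContinuousFunction.arzela_ascoli₂ (Set.Icc (-R) R) isCompact_Icc _
      (e.toHomeomorph.isClosedMap _ hcl) ?_ ?_
    · rintro _ x ⟨φ, hφ, rfl⟩
      exact abs_le.1 (hφ.1 x)
    · intro x
      rw [Metric.equicontinuousAt_iff_right]
      intro ε hε
      have hlim : Tendsto (fun y => a * dist x y) (𝓝 x) (𝓝 0) := by
        have : Continuous fun y => a * dist x y := by fun_prop
        simpa using this.tendsto x
      filter_upwards [hlim.eventually_lt_const hε] with y hy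
      rintro ⟨_, φ, hφ, rfl⟩
      exact (hφ.2 x y).trans_lt hy
  have := himg.image e.symm.continuous
  rwa [← Set.image_comp, show (e.symm ∘ e : C(X, ℝ) → C(X, ℝ)) = id from
    funext e.symm_apply_apply, Set.image_id] at this

theorem abs_integral_sub_integral_le_dist (φ ψ : C(X, ℝ)) (μ : Measure X)
    [IsProbabilityMeasure μ] : |∫ x, φ x ∂μ - ∫ x, ψ x ∂μ| ≤ dist φ ψ := by
  rw [← integral_sub (integrable_continuousMap φ μ) (integrable_continuousMap ψ μ)]
  exact abs_integral_le_of_bounded (fun x =>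
    (Real.dist_eq _ _).symm.trans_le (ContinuousMap.dist_apply_le_dist x)) μ

theorem continuous_integral_probabilityMeasure (φ : C(X, ℝ)) :
    Continuous fun z : ProbabilityMeasure X => ∫ x, φ x ∂(z : Measure X) :=
  continuous_iff_continuousAt.2 fun _ =>
    ProbabilityMeasure.tendsto_iff_forall_integral_tendsto.1 tendsto_id
      (BoundedContinuousFunction.mkOfCompact φ)

/-- The linear functionals given by a compact set of continuous functions are equicontinuous. -/
theorem eventually_abs_integral_sub_lt {A : Set C(X, ℝ)} (hA : IsCompact A)
    (z : ProbabilityMeasure X) {ε : ℝ} (hε : 0 < ε) :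
    ∀ᶠ z' : ProbabilityMeasure X in 𝓝 z,
      ∀ φ ∈ A, |∫ x, φ x ∂(z : Measure X) - ∫ x, φ x ∂(z' : Measure X)| < ε := by
  -- A finite `ε / 3`-net reduces the claim to finitely many weakly continuous functionals.
  obtain ⟨t, -, ht, hcov⟩ := hA.finite_cover_balls (show 0 < ε / 3 by positivity)
  have h1 : ∀ᶠ z' : ProbabilityMeasure X in 𝓝 z,
      ∀ ψ ∈ t, |∫ x, ψ x ∂(z' : Measure X) - ∫ x, ψ x ∂(z : Measure X)| < ε / 3 := by
    refine (eventually_all_finite ht).2 fun ψ _ => ?_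
    have := (continuous_integral_probabilityMeasure ψ).tendsto z
    exact Metric.tendsto_nhds.1 this (ε / 3) (by positivity)
  filter_upwards [h1] with z' hz' φ hφ
  obtain ⟨ψ, hψ, hφψ⟩ := Set.mem_iUnion₂.1 (hcov hφ)
  have a1 := abs_lt.1 (hz' ψ hψ)
  have a2 := abs_lt.1 ((abs_integral_sub_integral_le_dist φ ψ (z : Measure X)).trans_lt hφψ)
  have a3 := abs_lt.1 ((abs_integral_sub_integral_le_dist φ ψ (z' : Measure X)).trans_lt hφψ)
  exact abs_lt.2 ⟨by linarith [a1.1, a1.2], by linarith [a1.1, a1.2]⟩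

theorem IsEnvelope.abs_sub_le {A : Set C(X, ℝ)} {f : ProbabilityMeasure X → ℝ}
    (hf : IsEnvelope A f) {z z' : ProbabilityMeasure X} {ε : ℝ}
    (h : ∀ φ ∈ A, |∫ x, φ x ∂(z : Measure X) - ∫ x, φ x ∂(z' : Measure X)| ≤ ε) :
    |f z - f z'| ≤ ε := by
  refine abs_sub_le_iff.2 ⟨?_, ?_⟩
  · refine sub_le_iff_le_add.2 ((hf z).2 ?_)
    rintro _ ⟨φ, hφ, rfl⟩
    have h1 := (hf z').1 (Set.mem_image_of_mem _ hφ)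
    have h2 := (abs_le.1 (h φ hφ)).2
    simp only at h1 ⊢
    linarith
  · refine sub_le_iff_le_add.2 ((hf z').2 ?_)
    rintro _ ⟨φ, hφ, rfl⟩
    have h1 := (hf z).1 (Set.mem_image_of_mem _ hφ)
    have h2 := (abs_le.1 (h φ hφ)).1
    simp only at h1 ⊢
    linarith

/-- The empty set has no least upper bound in `ℝ`. -/
theorem IsEnvelope.nonempty [Nonempty X] {A : Set C(X, ℝ)} {f : ProbabilityMeasure X → ℝ}
    (hf : IsEnvelope A f) : A.Nonempty := by
  obtain ⟨x⟩ := ‹Nonempty X›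
  exact Set.image_nonempty.1 (hf (diracProba x)).nonempty

theorem IsEnvelope.abs_le {A : Set C(X, ℝ)} {f : ProbabilityMeasure X → ℝ}
    (hf : IsEnvelope A f) {R : ℝ} (hR : ∀ φ ∈ A, ∀ x, |φ x| ≤ R) (z : ProbabilityMeasure X) :
    |f z| ≤ R := by
  have hne : A.Nonempty := Set.image_nonempty.1 (hf z).nonempty
  refine _root_.abs_le.2 ⟨?_, (hf z).2 ?_⟩
  · obtain ⟨φ, hφ⟩ := hne
    exact (_root_.abs_le.1 (abs_integral_le_of_bounded (hR φ hφ) (z : Measure X))).1.trans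
      ((hf z).1 (Set.mem_image_of_mem _ hφ))
  · rintro _ ⟨φ, hφ, rfl⟩
    exact (_root_.abs_le.1 (abs_integral_le_of_bounded (hR φ hφ) (z : Measure X))).2

/-- An envelope is the envelope of a sequence. -/
theorem IsEnvelope.exists_seq [Nonempty X] {A : Set C(X, ℝ)} {f : ProbabilityMeasure X → ℝ}
    (hf : IsEnvelope A f) : ∃ d : ℕ → C(X, ℝ), (∀ n, d n ∈ A) ∧ IsEnvelope (Set.range d) f := by
  -- `A` is separable as a subset of `C(X, ℝ)`, and a dense sequence has the same suprema.
  -- Countability is what permits measurable selections.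
  have : Nonempty A := hf.nonempty.to_subtype
  refine ⟨fun n => TopologicalSpace.denseSeq A n, fun n => (TopologicalSpace.denseSeq A n).2,
    fun z => ⟨?_, fun b hb => (hf z).2 ?_⟩⟩
  · rintro _ ⟨_, ⟨n, rfl⟩, rfl⟩
    exact (hf z).1 (Set.mem_image_of_mem _ (TopologicalSpace.denseSeq A n).2)
  · rintro _ ⟨φ, hφ, rfl⟩
    refine le_of_forall_pos_le_add fun ε hε => ?_
    obtain ⟨n, hn⟩ := (TopologicalSpace.denseRange_denseSeq A).exists_dist_lt ⟨φ, hφ⟩ hε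
    have h1 := hb (Set.mem_image_of_mem _ (Set.mem_range_self n))
    have h2 := abs_integral_sub_integral_le_dist φ (TopologicalSpace.denseSeq A n) (z : Measure X)
    have h3 := (_root_.abs_le.1 h2).2
    have h4 : dist φ (TopologicalSpace.denseSeq A n) < ε := hn
    simp only at h1 ⊢
    linarith

theorem measurable_integral_probabilityMeasure (φ : C(X, ℝ)) :
    Measurable fun z : ProbabilityMeasure X => ∫ x, φ x ∂(z : Measure X) :=
  (continuous_integral_probabilityMeasure φ).measurable

theorem IsEnvelope.measurable [Nonempty X] {A : Set C(X, ℝ)} {f : ProbabilityMeasure X → ℝ}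
    (hf : IsEnvelope A f) : Measurable f := by
  obtain ⟨d, -, hd⟩ := hf.exists_seq
  refine Measurable.isLUB (f := fun n (z : ProbabilityMeasure X) => ∫ x, d n x ∂(z : Measure X))
    (fun n => measurable_integral_probabilityMeasure (d n)) fun z => ?_
  have := hd z
  rw [← Set.range_comp] at this
  exact this

end Support

/-! ### The filter kernel preserves and regularises envelopes. -/

section Regularity

variable {X Y : Type*} [MetricSpace X] [CompactSpace X] [Nonempty X] [MeasurableSpace X]
  [BorelSpace X] [MeasurableSpace Y] [StandardBorelSpace Y]
  {T : Kernel X X} [IsMarkovKernel T] {Q : Kernel X Y} [IsMarkovKernel Q]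

/-- The functions `w ↦ ∫ T(w, dx) ∫ Q(x, dy) d_{i(y)}(x)` for measurable selections `i`. -/
def selectionSet (T : Kernel X X) (Q : Kernel X Y) (d : ℕ → C(X, ℝ)) : Set C(X, ℝ) :=
  {φ | ∃ i : Y → ℕ, Measurable i ∧ ∀ w, φ w = ∫ x, ∫ y, d (i y) x ∂Q x ∂T w}

theorem measurable_selection (d : ℕ → C(X, ℝ)) {i : Y → ℕ} (hi : Measurable i) :
    Measurable fun p : Y × X => d (i p.1) p.2 := by
  have h : Measurable fun q : ℕ × X => d q.1 q.2 :=
    measurable_from_prod_countable_right fun n => (d n).continuous.measurable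
  exact h.comp ((hi.comp measurable_fst).prodMk measurable_snd)

theorem measurable_integral_selection (d : ℕ → C(X, ℝ)) {i : Y → ℕ} (hi : Measurable i) :
    Measurable fun x => ∫ y, d (i y) x ∂Q x :=
  (StronglyMeasurable.integral_kernel_prod_right' (κ := Q) (f := fun p : X × Y => d (i p.2) p.1)
    ((measurable_selection d hi).comp measurable_swap).stronglyMeasurable).measurable

/-- The inner integral is a measurable function of `x` bounded by `R`; total variation controls all
of these at once, so no regularity of `Q` enters. -/
theorem abs_selection_sub_le {α : ℝ} (hT : ∀ x x' : X, tvNorm (T x) (T x') ≤ dist x x' * α)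
    {d : ℕ → C(X, ℝ)} {R : ℝ} (hd : ∀ n x, |d n x| ≤ R) {i : Y → ℕ} (hi : Measurable i)
    (w w' : X) :
    |∫ x, ∫ y, d (i y) x ∂Q x ∂T w - ∫ x, ∫ y, d (i y) x ∂Q x ∂T w'| ≤ R * α * dist w w' := by
  have hR : 0 ≤ R := (abs_nonneg _).trans (hd 0 w)
  refine (abs_sub_integral_le_tvNorm (measurable_integral_selection d hi) (R := R)
    fun x => abs_integral_le_of_bounded (fun y => hd _ x) _).trans ?_
  refine (mul_le_mul_of_nonneg_left (hT w w') hR).trans_eq ?_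
  ring

theorem selectionSet_subset {α : ℝ} (hT : ∀ x x' : X, tvNorm (T x) (T x') ≤ dist x x' * α)
    {d : ℕ → C(X, ℝ)} {R : ℝ} (hd : ∀ n x, |d n x| ≤ R) :
    selectionSet T Q d ⊆ boundedLipschitz X R (R * α) := by
  rintro φ ⟨i, hi, hφ⟩
  refine ⟨fun w => ?_, fun w w' => ?_⟩
  · rw [hφ]
    exact abs_integral_le_of_bounded (fun x => abs_integral_le_of_bounded (fun y => hd _ x) _) _
  · rw [hφ, hφ]
    exact abs_selection_sub_le hT hd hi w w'

theorem exists_mem_selectionSet {α : ℝ} (hT : ∀ x x' : X, tvNorm (T x) (T x') ≤ dist x x' * α)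
    {d : ℕ → C(X, ℝ)} {R : ℝ} (hd : ∀ n x, |d n x| ≤ R) {i : Y → ℕ} (hi : Measurable i) :
    ∃ φ ∈ selectionSet T Q d, ∀ w, φ w = ∫ x, ∫ y, d (i y) x ∂Q x ∂T w := by
  have hL : LipschitzWith (Real.toNNReal (R * α)) fun w => ∫ x, ∫ y, d (i y) x ∂Q x ∂T w :=
    LipschitzWith.of_dist_le_mul fun w w' => by
      rw [Real.dist_eq]
      refine (abs_selection_sub_le hT hd hi w w').trans ?_
      exact mul_le_mul_of_nonneg_right (Real.le_coe_toNNReal _) dist_nonneg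
  exact ⟨⟨_, hL.continuous⟩, ⟨i, hi, fun _ => rfl⟩, fun _ => rfl⟩

/-- Averaging the conditional law over the observation gives back the joint law. The right side is
nonlinear in `z` term by term, the left side is linear. -/
theorem integral_selection_eq {d : ℕ → C(X, ℝ)} {R : ℝ} (hd : ∀ n x, |d n x| ≤ R) {i : Y → ℕ}
    (hi : Measurable i) (z : ProbabilityMeasure X) :
    ∫ w, ∫ x, ∫ y, d (i y) x ∂Q x ∂T w ∂(z : Measure X) =
      ∫ y, ∫ x, d (i y) x ∂(update T Q (z, y) : Measure X) ∂(predictor T Q).fst z := by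
  rw [← integral_predictor_eq_integral_update T Q (measurable_selection d hi) (fun p => hd _ _) z,
    integral_predictor T Q (measurable_selection d hi) (fun p => hd _ _) z]

/-- The filter kernel maps an envelope of functions bounded by `R` to an envelope of functions that
are bounded by `R` and uniformly Lipschitz. -/
theorem IsEnvelope.filterKernel {α : ℝ}
    (hT : ∀ x x' : X, tvNorm (T x) (T x') ≤ dist x x' * α) {A : Set C(X, ℝ)} {R : ℝ}
    (hA : ∀ φ ∈ A, ∀ x, |φ x| ≤ R) {f : ProbabilityMeasure X → ℝ} (hf : IsEnvelope A f) :
    ∃ B ⊆ boundedLipschitz X R (R * α),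
      IsEnvelope B fun z => ∫ z', f z' ∂HMM.filterKernel T Q z := by
  obtain ⟨d, hdA, hd⟩ := hf.exists_seq
  have hdR : ∀ n x, |d n x| ≤ R := fun n => hA _ (hdA n)
  refine ⟨selectionSet T Q d, selectionSet_subset hT hdR, fun z => ?_⟩
  have hfm := hf.measurable
  have hfR := hf.abs_le hA
  have hupd : Measurable fun y => update T Q (z, y) :=
    (measurable_update T Q).comp measurable_prodMk_left
  have hfi : Integrable (fun y => f (update T Q (z, y))) ((predictor T Q).fst z) :=
    integrable_of_bounded (hfm.comp hupd) (fun y => hfR _) _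
  have hdi : ∀ {i : Y → ℕ}, Measurable i →
      Integrable (fun y => ∫ x, d (i y) x ∂(update T Q (z, y) : Measure X))
        ((predictor T Q).fst z) := fun {i} hi => by
    refine integrable_of_bounded (R := R) ?_ (fun y => abs_integral_le_of_bounded (hdR _) _) _
    have h : Measurable fun q : ℕ × Y => ∫ x, d q.1 x ∂(update T Q (z, q.2) : Measure X) :=
      measurable_from_prod_countable_right fun n =>
        (measurable_integral_probabilityMeasure (d n)).comp hupd
    exact h.comp (hi.prodMk measurable_id)
  beta_reduce
  rw [integral_filterKernel T Q hfm hfR]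
  refine ⟨?_, fun b hb => le_of_forall_pos_le_add fun ε hε => ?_⟩
  · rintro _ ⟨φ, ⟨i, hi, hφ⟩, rfl⟩
    simp only [hφ]
    rw [integral_selection_eq hdR hi]
    exact integral_mono (hdi hi) hfi fun y => (hd _).1 (Set.mem_image_of_mem _ (Set.mem_range_self _))
  · classical
    -- The first `ε`-optimal index is a measurable selection attaining the supremum up to `ε`.
    have hex : ∀ y, ∃ n, f (update T Q (z, y)) - ε < ∫ x, d n x ∂(update T Q (z, y) : Measure X) := by
      intro y
      obtain ⟨_, ⟨_, ⟨n, rfl⟩, rfl⟩, hn, -⟩ := (hd (update T Q (z, y))).exists_between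
        (sub_lt_self _ hε)
      exact ⟨n, hn⟩
    have hi : Measurable fun y => Nat.find (hex y) := measurable_find hex fun n =>
      measurableSet_lt ((hfm.comp hupd).sub_const ε)
        ((measurable_integral_probabilityMeasure (d n)).comp hupd)
    obtain ⟨φ, hφ, hφe⟩ := exists_mem_selectionSet (Q := Q) hT hdR hi
    have h1 := hb (Set.mem_image_of_mem _ hφ)
    simp only [hφe] at h1
    rw [integral_selection_eq hdR hi] at h1
    have h2 : ∫ y, (f (update T Q (z, y)) - ε) ∂(predictor T Q).fst z ≤
        ∫ y, ∫ x, d (Nat.find (hex y)) x ∂(update T Q (z, y) : Measure X) ∂(predictor T Q).fst z :=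
      integral_mono (hfi.sub (integrable_const ε)) (hdi hi) fun y => (Nat.find_spec (hex y)).le
    rw [integral_sub hfi (integrable_const ε)] at h2
    simp only [integral_const, probReal_univ, smul_eq_mul, one_mul] at h2
    linarith

/-- The Lipschitz constant gained in one step depends only on the sup bound, which every step
preserves; hence one class serves all `n`. -/
theorem IsEnvelope.filterKernel_pow {α : ℝ}
    (hT : ∀ x x' : X, tvNorm (T x) (T x') ≤ dist x x' * α) {A : Set C(X, ℝ)} {R : ℝ}
    (hA : ∀ φ ∈ A, ∀ x, |φ x| ≤ R) {f : ProbabilityMeasure X → ℝ} (hf : IsEnvelope A f) (n : ℕ) :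
    ∃ B ⊆ boundedLipschitz X R (R * α),
      IsEnvelope B fun z => ∫ z', f z' ∂(HMM.filterKernel T Q ^ (n + 1)) z := by
  induction n with
  | zero =>
    simp_rw [zero_add, integral_pow_one]
    exact hf.filterKernel hT hA
  | succ n ih =>
    obtain ⟨B, hB, hBf⟩ := ih
    simp_rw [integral_pow_add _ hf.measurable (hf.abs_le hA) (n + 1) 1, integral_pow_one]
    exact hBf.filterKernel hT fun φ hφ => (hB hφ).1

/-- The iterates of a continuous envelope are equicontinuous. -/
theorem IsEnvelope.equicontinuous {α : ℝ}
    (hT : ∀ x x' : X, tvNorm (T x) (T x') ≤ dist x x' * α) {A : Set C(X, ℝ)} {R : ℝ}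
    (hA : ∀ φ ∈ A, ∀ x, |φ x| ≤ R) {f : C(ProbabilityMeasure X, ℝ)} (hf : IsEnvelope A f) :
    Equicontinuous fun (n : ℕ) z => ∫ z', f z' ∂(HMM.filterKernel T Q ^ n) z := by
  intro z
  rw [Metric.equicontinuousAt_iff_right]
  intro ε hε
  filter_upwards [Metric.tendsto_nhds.1 (f.continuous.tendsto z) ε hε,
    eventually_abs_integral_sub_lt (isCompact_boundedLipschitz (X := X) R (R * α)) z (half_pos hε)]
    with z' h0 h1 n
  -- No smoothing has taken place at time zero, where continuity of `f` is used instead.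
  cases n with
  | zero =>
    rw [integral_pow_zero _ f.continuous.measurable, integral_pow_zero _ f.continuous.measurable,
      dist_comm]
    exact h0
  | succ n =>
    obtain ⟨B, hB, hBf⟩ := hf.filterKernel_pow (Q := Q) hT hA n
    exact (hBf.abs_sub_le fun φ hφ => (h1 φ (hB hφ)).le).trans_lt (half_lt_self hε)

end Regularity

/-! ### Density of differences of envelopes. -/

section Density

variable {X : Type*} [MetricSpace X] [CompactSpace X] [MeasurableSpace X] [BorelSpace X]

/-- The continuous functions on `ProbabilityMeasure X` that are envelopes of a bounded set. -/
def envelopes (X : Type*) [MetricSpace X] [CompactSpace X] [MeasurableSpace X] [BorelSpace X] :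
    Set C(ProbabilityMeasure X, ℝ) :=
  {f | ∃ (A : Set C(X, ℝ)) (R : ℝ), (∀ φ ∈ A, ∀ x, |φ x| ≤ R) ∧ IsEnvelope A f}

theorem sup_mem_envelopes {f g : C(ProbabilityMeasure X, ℝ)} (hf : f ∈ envelopes X)
    (hg : g ∈ envelopes X) : f ⊔ g ∈ envelopes X := by
  obtain ⟨A, R, hA, hAf⟩ := hf
  obtain ⟨B, R', hB, hBg⟩ := hg
  refine ⟨A ∪ B, max R R', ?_, fun z => ?_⟩
  · rintro φ (hφ | hφ) x
    · exact (hA φ hφ x).trans (le_max_left _ _)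
    · exact (hB φ hφ x).trans (le_max_right _ _)
  · rw [Set.image_union]
    exact (hAf z).union (hBg z)

open scoped Pointwise in
theorem add_mem_envelopes {f g : C(ProbabilityMeasure X, ℝ)} (hf : f ∈ envelopes X)
    (hg : g ∈ envelopes X) : f + g ∈ envelopes X := by
  obtain ⟨A, R, hA, hAf⟩ := hf
  obtain ⟨B, R', hB, hBg⟩ := hg
  refine ⟨A + B, R + R', ?_, fun z => ?_⟩
  · rintro _ ⟨φ, hφ, ψ, hψ, rfl⟩ x
    exact (abs_add_le _ _).trans (add_le_add (hA φ hφ x) (hB ψ hψ x))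
  · have himg : (fun φ : C(X, ℝ) => ∫ x, φ x ∂(z : Measure X)) '' (A + B) =
        (fun φ : C(X, ℝ) => ∫ x, φ x ∂(z : Measure X)) '' A +
          (fun φ : C(X, ℝ) => ∫ x, φ x ∂(z : Measure X)) '' B := by
      refine Set.image_image2_distrib fun φ ψ => ?_
      exact integral_add (integrable_continuousMap φ _) (integrable_continuousMap ψ _)
    rw [himg]
    exact (hAf z).add (hBg z)

/-- The linear functional `z ↦ ∫ φ dz`. -/
noncomputable def linearFunctional (φ : C(X, ℝ)) : C(ProbabilityMeasure X, ℝ) :=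
  ⟨fun z => ∫ x, φ x ∂(z : Measure X), continuous_integral_probabilityMeasure φ⟩

theorem linearFunctional_mem_envelopes (φ : C(X, ℝ)) : linearFunctional φ ∈ envelopes X := by
  refine ⟨{φ}, ‖φ‖, ?_, fun z => ?_⟩
  · rintro _ rfl x
    exact abs_le_norm _ x
  · rw [Set.image_singleton]
    exact isLUB_singleton

/-- The differences of envelopes are dense in the continuous functions. -/
theorem closure_sub_envelopes :
    closure {h : C(ProbabilityMeasure X, ℝ) | ∃ f ∈ envelopes X, ∃ g ∈ envelopes X, h = f - g} =
      ⊤ := by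
  have h0 := linearFunctional_mem_envelopes (0 : C(X, ℝ))
  have hsup : ∀ f₁ ∈ envelopes X, ∀ g₁ ∈ envelopes X, ∀ f₂ ∈ envelopes X, ∀ g₂ ∈ envelopes X,
      ∃ f ∈ envelopes X, ∃ g ∈ envelopes X, (f₁ - g₁) ⊔ (f₂ - g₂) = f - g := by
    intro f₁ hf₁ g₁ hg₁ f₂ hf₂ g₂ hg₂
    -- The supremum of the differences is `(f₁ + g₂) ⊔ (f₂ + g₁) - (g₁ + g₂)`.
    refine ⟨_, sup_mem_envelopes (add_mem_envelopes hf₁ hg₂) (add_mem_envelopes hf₂ hg₁), _,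
      add_mem_envelopes hg₁ hg₂, ?_⟩
    ext z
    simp only [ContinuousMap.sup_apply, ContinuousMap.sub_apply, ContinuousMap.add_apply]
    rw [← max_sub_sub_right]
    congr 1 <;> ring
  refine ContinuousMap.sublattice_closure_eq_top _ ⟨_, _, h0, _, h0, rfl⟩ ?_ ?_ ?_
  · rintro _ ⟨f₁, hf₁, g₁, hg₁, rfl⟩ _ ⟨f₂, hf₂, g₂, hg₂, rfl⟩
    obtain ⟨f, hf, g, hg, h⟩ := hsup g₁ hg₁ f₁ hf₁ g₂ hg₂ f₂ hf₂
    refine ⟨g, hg, f, hf, ?_⟩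
    rw [← neg_sub f g, ← h]
    ext z
    simp only [ContinuousMap.inf_apply, ContinuousMap.sub_apply, ContinuousMap.neg_apply,
      ContinuousMap.sup_apply]
    rw [← min_neg_neg, neg_sub, neg_sub]
  · rintro _ ⟨f₁, hf₁, g₁, hg₁, rfl⟩ _ ⟨f₂, hf₂, g₂, hg₂, rfl⟩
    exact hsup f₁ hf₁ g₁ hg₁ f₂ hf₂ g₂ hg₂
  · intro v z z'
    suffices h : ∃ φ : C(X, ℝ), ∫ x, φ x ∂(z : Measure X) = v z ∧
        ∫ x, φ x ∂(z' : Measure X) = v z' by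
      obtain ⟨φ, h1, h2⟩ := h
      refine ⟨_, ⟨_, linearFunctional_mem_envelopes φ, _, h0, rfl⟩, ?_, ?_⟩
      · simpa [linearFunctional] using h1
      · simpa [linearFunctional] using h2
    by_cases hzz : z = z'
    · subst hzz
      exact ⟨ContinuousMap.const X (v z), by simp, by simp⟩
    · have hex : ∃ φ : C(X, ℝ), ∫ x, φ x ∂(z : Measure X) ≠ ∫ x, φ x ∂(z' : Measure X) := by
        by_contra! hcon
        have heq : (z : Measure X) = (z' : Measure X) :=
          measure_eq_of_forall_integral_continuousMap_eq hcon
        exact hzz (Subtype.ext heq)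
      obtain ⟨φ, hφ⟩ := hex
      have hne := sub_ne_zero.2 hφ
      -- The affine function of `φ` whose integrals against `z` and `z'` are the prescribed values.
      refine ⟨((v z - v z') / (∫ x, φ x ∂(z : Measure X) - ∫ x, φ x ∂(z' : Measure X))) • φ +
        ContinuousMap.const X (v z' - (v z - v z') / (∫ x, φ x ∂(z : Measure X) -
          ∫ x, φ x ∂(z' : Measure X)) * ∫ x, φ x ∂(z' : Measure X)), ?_, ?_⟩
      all_goals
        simp only [ContinuousMap.add_apply, ContinuousMap.smul_apply, ContinuousMap.const_apply,
          smul_eq_mul]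
        rw [integral_add ((integrable_continuousMap φ _).const_mul _) (integrable_const _),
          integral_const_mul, integral_const, probReal_univ, one_smul]
        field_simp
        ring

end Density

/-! ### The filter process is an e-chain. -/

section EChain

variable {X Y : Type*} [MetricSpace X] [CompactSpace X] [Nonempty X] [MeasurableSpace X]
  [BorelSpace X] [MeasurableSpace Y] [StandardBorelSpace Y]
  {T : Kernel X X} [IsMarkovKernel T] {Q : Kernel X Y} [IsMarkovKernel Q]

/-- If `T` is Lipschitz in total variation, the filter process is an e-chain. -/
theorem isEChain_filterKernel {α : ℝ}
    (hT : ∀ x x' : X, tvNorm (T x) (T x') ≤ dist x x' * α) :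
    IsEChain (HMM.filterKernel T Q) := by
  intro h z
  rw [Metric.equicontinuousAt_iff_right]
  intro ε hε
  have hmem : h ∈ closure {h : C(ProbabilityMeasure X, ℝ) |
      ∃ f ∈ envelopes X, ∃ g ∈ envelopes X, h = f - g} := by
    rw [closure_sub_envelopes]; trivial
  obtain ⟨_, ⟨f, ⟨A, R, hA, hAf⟩, g, ⟨B, R', hB, hBg⟩, rfl⟩, hfg⟩ :=
    Metric.mem_closure_iff.1 hmem (ε / 4) (by positivity)
  have e1 := Metric.equicontinuousAt_iff_right.1 (hAf.equicontinuous (Q := Q) hT hA z) (ε / 4)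
    (by positivity)
  have e2 := Metric.equicontinuousAt_iff_right.1 (hBg.equicontinuous (Q := Q) hT hB z) (ε / 4)
    (by positivity)
  have hclose : ∀ (n : ℕ) w, |∫ z', h z' ∂(HMM.filterKernel T Q ^ n) w -
      (∫ z', f z' ∂(HMM.filterKernel T Q ^ n) w - ∫ z', g z' ∂(HMM.filterKernel T Q ^ n) w)| <
        ε / 4 := by
    intro n w
    rw [← integral_sub (integrable_continuousMap f _) (integrable_continuousMap g _)]
    change |_ - ∫ z', (f - g) z' ∂(HMM.filterKernel T Q ^ n) w| < _
    rw [← integral_sub (integrable_continuousMap h _) (integrable_continuousMap (f - g) _)]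
    refine (abs_integral_le_of_bounded (R := dist h (f - g)) (fun y => ?_) _).trans_lt hfg
    exact (Real.dist_eq _ _).symm.trans_le (ContinuousMap.dist_apply_le_dist y)
  filter_upwards [e1, e2] with z' h1 h2 n
  have a1 := abs_lt.1 (h1 n)
  have a2 := abs_lt.1 (h2 n)
  have a3 := abs_lt.1 (hclose n z)
  have a4 := abs_lt.1 (hclose n z')
  exact abs_lt.2 ⟨by linarith [a1.1, a2.2, a3.1, a4.2], by linarith [a1.2, a2.1, a3.2, a4.1]⟩

end EChain

/-! ### The filter recursion and the law of the filter. -/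

section FilterProcess

variable {X Y : Type*} [MeasurableSpace X] [MeasurableSpace Y]
  (T : Kernel X X) (Q : Kernel X Y) [IsMarkovKernel T] [IsMarkovKernel Q]

/-- `predictor` puts the observation first so that `condKernel` conditions on it; this reconciles
the two orders. -/
theorem pairKernel_swap_preimage (p : X × Y) {A : Set (Y × X)} (hA : MeasurableSet A) :
    pairKernel T Q p (Prod.swap ⁻¹' A) = ((Q ×ₖ Kernel.id) ∘ₖ T) p.1 A := by
  unfold pairKernel
  rw [Kernel.comp_apply' _ _ _ (measurable_swap hA), Kernel.comp_apply' _ _ _ hA,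
    Kernel.comap_apply]
  congr 1 with x
  rw [Kernel.prod_apply, Kernel.prod_apply, ← Measure.map_apply measurable_swap hA,
    Measure.prod_swap]

theorem predictor_apply (z : ProbabilityMeasure X) {A : Set (Y × X)} (hA : MeasurableSet A) :
    predictor T Q z A = ∫⁻ x, ((Q ×ₖ Kernel.id) ∘ₖ T) x A ∂(z : Measure X) :=
  Kernel.comp_apply' _ _ _ hA

theorem measurable_kernel_snd_preimage {β Z : Type*} [MeasurableSpace β] [MeasurableSpace Z]
    (κ : Kernel X Z) [IsMarkovKernel κ] {s : Set (β × Z)} (hs : MeasurableSet s) :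
    Measurable fun q : β × X => κ q.2 (Prod.mk q.1 ⁻¹' s) := by
  have ht : MeasurableSet {r : (β × X) × Z | (r.1.1, r.2) ∈ s} :=
    ((measurable_fst.comp measurable_fst).prodMk measurable_snd) hs
  exact Kernel.measurable_kernel_prodMk_left (κ := κ.comap Prod.snd measurable_snd) ht

theorem measurable_observations (n : ℕ) : Measurable (observations (X := X) (Y := Y) n) :=
  measurable_pi_lambda _ fun _ => (measurable_pi_apply _).snd

variable [StandardBorelSpace X] [Nonempty X]

/-- The filter at time `n` as a function of the observations. -/
noncomputable def filterOf (μ : ProbabilityMeasure X) (n : ℕ) (o : Finset.Iic n → Y) :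
    ProbabilityMeasure X :=
  ⟨condDistrib (fun ω' : ℕ → X × Y => (ω' n).1) (observations n) (pathLaw T Q μ) o, inferInstance⟩

theorem measurable_filterOf (μ : ProbabilityMeasure X) (n : ℕ) :
    Measurable (filterOf T Q μ n) :=
  Measurable.subtype_mk (Kernel.measurable _)

/-- The conditional law of `(Y_{n+1}, X_{n+1})` given the observations up to time `n` is the
predictor at the filter. -/
theorem map_observations_next (μ : ProbabilityMeasure X) (n : ℕ) :
    (pathLaw T Q μ).map (fun ω => (observations n ω, (ω (n + 1)).swap)) =
      (pathLaw T Q μ).map (observations n) ⊗ₘ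
        (predictor T Q).comap (filterOf T Q μ n) (measurable_filterOf T Q μ n) := by
  have hpast : (pathLaw T Q μ).map (fun ω => (Preorder.frestrictLe n ω, ω (n + 1))) =
      (pathLaw T Q μ).map (Preorder.frestrictLe n) ⊗ₘ pathKernel T Q n :=
    (Kernel.map_frestrictLe_trajMeasure_compProd_eq_map_trajMeasure
      (X := fun _ => X × Y) (κ := pathKernel T Q)).symm
  have hXn : Measurable fun ω : ℕ → X × Y => (ω n).1 := (measurable_pi_apply n).fst
  have hO := measurable_observations (X := X) (Y := Y) n
  ext s hs
  have hobs : Measurable fun p : Finset.Iic n → X × Y => fun i => (p i).2 :=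
    measurable_pi_lambda _ fun i => (measurable_pi_apply i).snd
  have hs₁ : MeasurableSet {q : (Finset.Iic n → X × Y) × (X × Y) |
      ((fun i => (q.1 i).2), q.2.swap) ∈ s} :=
    ((hobs.comp measurable_fst).prodMk (measurable_swap.comp measurable_snd)) hs
  have hmeas : Measurable fun q : (Finset.Iic n → Y) × X =>
      ((Q ×ₖ Kernel.id) ∘ₖ T) q.2 (Prod.mk q.1 ⁻¹' s) := measurable_kernel_snd_preimage _ hs
  calc (pathLaw T Q μ).map (fun ω => (observations n ω, (ω (n + 1)).swap)) s
      = (pathLaw T Q μ).map (fun ω => (Preorder.frestrictLe n ω, ω (n + 1)))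
          {q | ((fun i => (q.1 i).2), q.2.swap) ∈ s} := by
        have hm : Measurable fun ω : ℕ → X × Y => (observations n ω, (ω (n + 1)).swap) :=
          hO.prodMk (measurable_swap.comp (measurable_pi_apply _))
        rw [Measure.map_apply hm hs,
          Measure.map_apply ((Preorder.measurable_frestrictLe n).prodMk (measurable_pi_apply _)) hs₁]
        rfl
    _ = ∫⁻ ω, ((Q ×ₖ Kernel.id) ∘ₖ T) (ω n).1 (Prod.mk (observations n ω) ⁻¹' s)
          ∂pathLaw T Q μ := by
        rw [hpast, Measure.compProd_apply hs₁, lintegral_map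
          (Kernel.measurable_kernel_prodMk_left hs₁) (Preorder.measurable_frestrictLe n)]
        refine lintegral_congr fun ω => ?_
        exact pairKernel_swap_preimage T Q (ω n) (A := Prod.mk (observations n ω) ⁻¹' s)
          (measurable_prodMk_left hs)
    _ = ∫⁻ q, ((Q ×ₖ Kernel.id) ∘ₖ T) q.2 (Prod.mk q.1 ⁻¹' s)
          ∂(pathLaw T Q μ).map (fun ω => (observations n ω, (ω n).1)) := by
        rw [lintegral_map hmeas (hO.prodMk hXn)]
    _ = _ := by
        -- Tower property: the law of `X_n` given the observations is the filter, and integrating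
        -- the one-step kernel against it gives the predictor.
        rw [← compProd_map_condDistrib hXn.aemeasurable, Measure.lintegral_compProd hmeas,
          Measure.compProd_apply hs]
        refine lintegral_congr fun o => ?_
        rw [Kernel.comap_apply, predictor_apply T Q _ (measurable_prodMk_left hs)]
        rfl

variable [StandardBorelSpace Y]

theorem filterKernel_apply (z : ProbabilityMeasure X) {A : Set (ProbabilityMeasure X)}
    (hA : MeasurableSet A) :
    filterKernel T Q z A = (predictor T Q).fst z {y | update T Q (z, y) ∈ A} := by
  unfold filterKernel
  rw [Kernel.map_apply' _ (measurable_update T Q) _ hA, Kernel.prod_apply, Kernel.id_apply,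
    Measure.dirac_prod, Measure.map_apply measurable_prodMk_left (measurable_update T Q hA)]
  rfl

/-- Disintegration of the predictor: the conditional law of `X_{n+1}` given the observations up to
time `n + 1` is the update. -/
theorem map_observations_next_assoc (μ : ProbabilityMeasure X) (n : ℕ) :
    (pathLaw T Q μ).map (fun ω => ((observations n ω, (ω (n + 1)).2), (ω (n + 1)).1)) =
      ((pathLaw T Q μ).map (observations n) ⊗ₘ
        (predictor T Q).fst.comap (filterOf T Q μ n) (measurable_filterOf T Q μ n)) ⊗ₘ
        (predictor T Q).condKernel.comap
          (fun p : (Finset.Iic n → Y) × Y => (filterOf T Q μ n p.1, p.2))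
          (((measurable_filterOf T Q μ n).comp measurable_fst).prodMk measurable_snd) := by
  have hdis : (predictor T Q).comap (filterOf T Q μ n) (measurable_filterOf T Q μ n) =
      (predictor T Q).fst.comap (filterOf T Q μ n) (measurable_filterOf T Q μ n) ⊗ₖ
        (predictor T Q).condKernel.comap
          (fun p : (Finset.Iic n → Y) × Y => (filterOf T Q μ n p.1, p.2))
          (((measurable_filterOf T Q μ n).comp measurable_fst).prodMk measurable_snd) := by
    ext o s hs
    rw [Kernel.comap_apply, Kernel.compProd_apply hs]
    conv_lhs => rw [← (predictor T Q).disintegrate (predictor T Q).condKernel]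
    rw [Kernel.compProd_apply hs]
    rfl
  have hm : Measurable fun ω : ℕ → X × Y => (observations n ω, (ω (n + 1)).swap) :=
    (measurable_observations n).prodMk (measurable_swap.comp (measurable_pi_apply _))
  rw [← Measure.compProd_assoc, ← hdis, ← map_observations_next,
    Measure.map_map (MeasurableEquiv.measurable _) hm]
  rfl

theorem map_observations_next_fst (μ : ProbabilityMeasure X) (n : ℕ) :
    (pathLaw T Q μ).map (fun ω => (observations n ω, (ω (n + 1)).2)) =
      (pathLaw T Q μ).map (observations n) ⊗ₘ
        (predictor T Q).fst.comap (filterOf T Q μ n) (measurable_filterOf T Q μ n) := by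
  have h := congrArg Measure.fst (map_observations_next_assoc T Q μ n)
  rw [Measure.fst_compProd, Measure.fst_map_prodMk (measurable_pi_apply _).fst] at h
  exact h

/-- Split the observations up to time `n + 1` into those up to time `n` and the last one. -/
def splitLast (n : ℕ) (o : Finset.Iic (n + 1) → Y) : (Finset.Iic n → Y) × Y :=
  (fun i => o ⟨i, Finset.mem_Iic.2 ((Finset.mem_Iic.1 i.2).trans n.le_succ)⟩,
    o ⟨n + 1, Finset.mem_Iic.2 le_rfl⟩)

/-- The inverse of `splitLast`. -/
def appendLast (n : ℕ) (p : (Finset.Iic n → Y) × Y) : Finset.Iic (n + 1) → Y :=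
  fun i => if h : (i : ℕ) ≤ n then p.1 ⟨i, Finset.mem_Iic.2 h⟩ else p.2

theorem measurable_splitLast (n : ℕ) : Measurable (splitLast (Y := Y) n) :=
  (measurable_pi_lambda _ fun _ => measurable_pi_apply _).prodMk (measurable_pi_apply _)

theorem measurable_appendLast (n : ℕ) : Measurable (appendLast (Y := Y) n) := by
  refine measurable_pi_lambda _ fun i => ?_
  unfold appendLast
  split_ifs with h
  · exact (measurable_pi_apply _).comp measurable_fst
  · exact measurable_snd

theorem appendLast_splitLast (n : ℕ) (o : Finset.Iic (n + 1) → Y) :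
    appendLast n (splitLast n o) = o := by
  ext i
  unfold appendLast splitLast
  split_ifs with h
  · rfl
  · have hi : (i : ℕ) = n + 1 := le_antisymm (Finset.mem_Iic.1 i.2) (not_le.1 h)
    exact congrArg o (Subtype.ext hi.symm)

/-- The filter recursion `π_{n+1} = F(π_n, Y_{n+1})`. -/
theorem filter_succ_ae_eq (μ : ProbabilityMeasure X) (n : ℕ) :
    filter T Q μ (n + 1) =ᵐ[pathLaw T Q μ]
      fun ω => update T Q (filterOf T Q μ n (observations n ω), (ω (n + 1)).2) := by
  have hg : Measurable fun p : (Finset.Iic n → Y) × Y => (filterOf T Q μ n p.1, p.2) :=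
    ((measurable_filterOf T Q μ n).comp measurable_fst).prodMk measurable_snd
  have hX : Measurable fun ω : ℕ → X × Y => (ω (n + 1)).1 := (measurable_pi_apply _).fst
  have hO := measurable_observations (X := X) (Y := Y) (n + 1)
  have hO' : Measurable fun ω : ℕ → X × Y => (observations n ω, (ω (n + 1)).2) :=
    (measurable_observations n).prodMk (measurable_pi_apply _).snd
  -- Conditional laws are almost surely unique, so it suffices that the update disintegrates the
  -- joint law. `appendLast` transports this from pairs (past, last observation) to tuples.
  have hae := condDistrib_ae_eq_of_measure_eq_compProd_of_measurable (μ := pathLaw T Q μ) hO hX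
    (κ := (predictor T Q).condKernel.comap _ (hg.comp (measurable_splitLast n))) (by
      ext s hs
      have hs' : MeasurableSet {q : ((Finset.Iic n → Y) × Y) × X | (appendLast n q.1, q.2) ∈ s} :=
        (((measurable_appendLast n).comp measurable_fst).prodMk measurable_snd) hs
      rw [Measure.compProd_apply hs, lintegral_map (Kernel.measurable_kernel_prodMk_left hs) hO]
      have h := congrArg (fun m => m {q | (appendLast n q.1, q.2) ∈ s})
        (map_observations_next_assoc T Q μ n)
      rw [← map_observations_next_fst, Measure.compProd_apply hs',
        lintegral_map (Kernel.measurable_kernel_prodMk_left hs') hO',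
        Measure.map_apply (hO'.prodMk hX) hs'] at h
      rw [Measure.map_apply (hO.prodMk hX) hs]
      have hsplit : ∀ ω : ℕ → X × Y,
          appendLast n (observations n ω, (ω (n + 1)).2) = observations (n + 1) ω :=
        fun ω => appendLast_splitLast n (observations (n + 1) ω)
      have hset : ∀ ω : ℕ → X × Y, Prod.mk (observations n ω, (ω (n + 1)).2) ⁻¹'
          {q : ((Finset.Iic n → Y) × Y) × X | (appendLast n q.1, q.2) ∈ s} =
            Prod.mk (observations (n + 1) ω) ⁻¹' s := fun ω => by
        rw [← hsplit ω]
        rfl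
      refine Eq.trans (congrArg (pathLaw T Q μ) (Set.ext fun ω => ?_)) (h.trans
        (lintegral_congr fun ω => ?_))
      · exact Set.ext_iff.1 (hset ω).symm (ω (n + 1)).1
      · rw [hset ω]
        rfl)
  filter_upwards [ae_of_ae_map hO.aemeasurable hae] with ω hω
  exact Subtype.ext hω

/-- Given the past observations, `Y_{n+1}` has the predictor's first marginal at the filter, so the
recursion draws its next value from `filterKernel` there. -/
theorem filterLaw_succ (μ : ProbabilityMeasure X) (n : ℕ) :
    (filterLaw T Q μ (n + 1) : Measure (ProbabilityMeasure X)) =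
      filterKernel T Q ∘ₘ (filterLaw T Q μ n : Measure (ProbabilityMeasure X)) := by
  have hO := measurable_observations (X := X) (Y := Y) n
  have hO' : Measurable fun ω : ℕ → X × Y => (observations n ω, (ω (n + 1)).2) :=
    hO.prodMk (measurable_pi_apply _).snd
  have hup : Measurable fun p : (Finset.Iic n → Y) × Y => update T Q (filterOf T Q μ n p.1, p.2) :=
    (measurable_update T Q).comp
      (((measurable_filterOf T Q μ n).comp measurable_fst).prodMk measurable_snd)
  change (pathLaw T Q μ).map (filter T Q μ (n + 1)) =
    filterKernel T Q ∘ₘ (pathLaw T Q μ).map (filter T Q μ n)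
  rw [Measure.map_congr (filter_succ_ae_eq T Q μ n)]
  ext A hA
  rw [Measure.bind_apply hA (Kernel.aemeasurable _),
    lintegral_map (Kernel.measurable_coe _ hA) (measurable_filter T Q μ n),
    show (fun ω : ℕ → X × Y => update T Q (filterOf T Q μ n (observations n ω), (ω (n + 1)).2)) =
      (fun p : (Finset.Iic n → Y) × Y => update T Q (filterOf T Q μ n p.1, p.2)) ∘
        fun ω => (observations n ω, (ω (n + 1)).2) from rfl,
    ← Measure.map_map hup hO', map_observations_next_fst, Measure.map_apply hup hA,
    Measure.compProd_apply (hup hA), lintegral_map (Kernel.measurable_kernel_prodMk_left (hup hA)) hO]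
  refine lintegral_congr fun ω => ?_
  rw [filterKernel_apply T Q _ hA]
  rfl

/-- The law of the filter at time `n` is obtained by running the filter kernel for `n` steps. -/
theorem filterLaw_eq_chainLaw (μ : ProbabilityMeasure X) (n : ℕ) :
    filterLaw T Q μ n = chainLaw (filterKernel T Q) (filterLaw T Q μ 0) n := by
  refine Subtype.ext ?_
  change (filterLaw T Q μ n : Measure (ProbabilityMeasure X)) =
    (filterKernel T Q ^ n : Kernel _ _) ∘ₘ (filterLaw T Q μ 0 : Measure (ProbabilityMeasure X))
  induction n with
  | zero => rw [pow_zero]; exact Measure.id_comp.symm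
  | succ n ih =>
    have h : filterKernel T Q ^ (n + 1) = filterKernel T Q ∘ₖ (filterKernel T Q ^ n) :=
      pow_succ' _ n
    rw [filterLaw_succ, ih, h, Measure.comp_assoc]

end FilterProcess

end HMM

theorem theorem2p2
    {X Y : Type*}
    [MetricSpace X] [CompactSpace X] [Nonempty X] [MeasurableSpace X] [BorelSpace X]
    [TopologicalSpace Y] [PolishSpace Y] [MeasurableSpace Y] [BorelSpace Y]
    (T : Kernel X X) [IsMarkovKernel T]
    (Q : Kernel X Y) [IsMarkovKernel Q]
    (hT : ∃ α : ℝ, 0 ≤ α ∧ ∀ x x' : X, HMM.tvNorm (T x) (T x') ≤ dist x x' * α)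
    (hreach : ∃ z : ProbabilityMeasure X,
      HMM.TopologicallyReachable (HMM.filterKernel T Q) z) :
    (∃! ν : ProbabilityMeasure (ProbabilityMeasure X),
      Kernel.Invariant (HMM.filterKernel T Q) (ν : Measure (ProbabilityMeasure X))) ∧
    ∀ z : ProbabilityMeasure X,
      HMM.TopologicallyReachable (HMM.filterKernel T Q) z →
      HMM.TopologicallyAperiodic (HMM.filterKernel T Q) z →
      ∀ ν : ProbabilityMeasure (ProbabilityMeasure X),
        Kernel.Invariant (HMM.filterKernel T Q) (ν : Measure (ProbabilityMeasure X)) →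
        (∀ μ : ProbabilityMeasure X,
          Tendsto (fun n : ℕ => HMM.filterLaw T Q μ n) atTop (𝓝 ν)) ∧
        (∀ m : ProbabilityMeasure (ProbabilityMeasure X),
          Tendsto (fun n : ℕ => HMM.chainLaw (HMM.filterKernel T Q) m n) atTop (𝓝 ν)) := by
  obtain ⟨α, -, hT⟩ := hT
  have hE : HMM.IsEChain (HMM.filterKernel T Q) := HMM.isEChain_filterKernel hT
  obtain ⟨z₀, hz₀⟩ := hreach
  refine ⟨?_, fun z hz hza ν hν => ⟨fun μ => ?_, fun m => hE.tendsto_chainLaw hz hza hν m⟩⟩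
  · have : Nonempty (ProbabilityMeasure X) := ⟨z₀⟩
    obtain ⟨ν, hν⟩ := hE.exists_invariant
    refine ⟨ν, hν, fun ν' hν' => Subtype.ext ?_⟩
    exact HMM.measure_eq_of_forall_integral_continuousMap_eq
      (μ := (ν' : Measure (ProbabilityMeasure X))) (ν := (ν : Measure (ProbabilityMeasure X)))
      (hE.integral_eq_of_invariant hz₀ hν' hν)
  · exact (hE.tendsto_chainLaw hz hza hν (HMM.filterLaw T Q μ 0)).congr fun n =>
      (HMM.filterLaw_eq_chainLaw T Q μ n).symm
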